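/- Consider a deterministic two-period overlapping generations economy, $t=0,1,2,\dots$, with one asset in unit supply (initially held by the old). Generation $t$ has utility $U(y_t,z_{t+1})$ over consumption when young and old, where $U:(0,\infty)^2\to(0,\infty)$ is homogeneous of degree $1$, twice continuously differentiable, with $U_y,U_z>0$, $U_{yy},U_{zz}<0$ and the Inada conditions $\lim_{y\downarrow0}U_y(y,z)=\infty$ for all $z>0$ and $\lim_{z\downarrow0}U_z(y,z)=\infty$ for all $y>0$. Endowments of the young and the old at date $t$ are $(aG^t,bG^t)$ and the dividend is $D_t=DG_d^t$, where $a>0$, $b\ge0$, $D>0$ and $0<G_d<G$. An equilibrium is a sequence $(P_t,x_t,y_t,z_t)_{t\ge0}$ with asset price $P_t>0$ and consumption $y_t,z_t>0$ such that: $x=x_t$ maximizes $U(aG^t-P_tx,\;bG^{t+1}+(P_{t+1}+D_{t+1})x)$ over all $x$ for which both arguments are positive, with $y_t=aG^t-P_tx_t$ and $z_{t+1}=bG^{t+1}+(P_{t+1}+D_{t+1})x_t$; the initial old consume $z_0=b+P_0+D_0$; and markets clear, $x_t=1$ and $y_t+z_t=aG^t+bG^t+D_t$. Let $R_t=(P_{t+1}+D_{t+1})/P_t$,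 $q_t=1/\prod_{s<t}R_s$ and let $V_t=q_t^{-1}\sum_{s>t}q_sD_s$ be the fundamental value of the asset. An equilibrium is fundamental if $P_t=V_t$ for all $t$, and bubbly if $P_t>V_t$ for all $t$. Then there is a unique $w_f^*>0$ with $(U_y/U_z)(1,Gw_f^*)=G_d$ and a unique $w_b^*>0$ with $(U_y/U_z)(1,Gw_b^*)=G$; moreover $w_f^*<w_b^*$, and with $w=b/a$ the following hold. (i) If $w>w_f^*$, there exists a unique equilibrium such that $G_d^{-t}P_t$ converges to a positive number, and it is fundamental. (ii) If $w<w_b^*$, there exists a bubbly equilibrium such that $G^{-t}P_t$ converges to a positive number. If in addition $w<w_f^*$, there exists no fundamental equilibrium. (iii) If $w_f^*<w<w_b^*$, the set of equilibria such that $G^{-t}P_t\to0$ has the cardinality of the continuum; the equilibrium in (i) belongs to it and is fundamental, and all its other members are bubbly. -/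

import Mathlib

open Filter Topology

namespace OLG

/-! ### Utility functions of two consumption levels `(y, z)` (young, old) -/

/-- The partial derivative `U_y`. -/
noncomputable def Uy (U : ℝ → ℝ → ℝ) (y z : ℝ) : ℝ := deriv (fun s => U s z) y

/-- The partial derivative `U_z`. -/
noncomputable def Uz (U : ℝ → ℝ → ℝ) (y z : ℝ) : ℝ := deriv (fun s => U y s) z

/-- The second partial derivative `U_yy`. -/
noncomputable def Uyy (U : ℝ → ℝ → ℝ) (y z : ℝ) : ℝ := deriv (fun s => Uy U s z) y

/-- The second partial derivative `U_zz`. -/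
noncomputable def Uzz (U : ℝ → ℝ → ℝ) (y z : ℝ) : ℝ := deriv (fun s => Uz U y s) z

/-- The marginal rate of substitution `U_y / U_z`. -/
noncomputable def mrs (U : ℝ → ℝ → ℝ) (y z : ℝ) : ℝ := Uy U y z / Uz U y z

/-- Standing assumptions on the utility function. Only the values of `U` on the open positive
quadrant matter; the Inada conditions are limits at the boundary of the quadrant. -/
structure IsRegularUtility (U : ℝ → ℝ → ℝ) : Prop where
  pos : ∀ y z, 0 < y → 0 < z → 0 < U y z
  homogeneous : ∀ c y z, 0 < c → 0 < y → 0 < z → U (c * y) (c * z) = c * U y z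
  contDiffOn : ContDiffOn ℝ 2 (fun p : ℝ × ℝ => U p.1 p.2) (Set.Ioi 0 ×ˢ Set.Ioi 0)
  Uy_pos : ∀ y z, 0 < y → 0 < z → 0 < Uy U y z
  Uz_pos : ∀ y z, 0 < y → 0 < z → 0 < Uz U y z
  Uyy_neg : ∀ y z, 0 < y → 0 < z → Uyy U y z < 0
  Uzz_neg : ∀ y z, 0 < y → 0 < z → Uzz U y z < 0
  inada_y : ∀ z, 0 < z → Tendsto (fun y => Uy U y z) (𝓝[>] 0) atTop
  inada_z : ∀ y, 0 < y → Tendsto (fun z => Uz U y z) (𝓝[>] 0) atTop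

/-! ### The economy and its equilibria -/

/-- A deterministic two-period overlapping generations economy with one asset in unit supply. -/
structure Economy where
  /-- lifetime utility of every generation, on the open positive quadrant -/
  U : ℝ → ℝ → ℝ
  /-- endowment of the young -/
  young : ℕ → ℝ
  /-- endowment of the old -/
  old : ℕ → ℝ
  /-- dividend of the asset -/
  dividend : ℕ → ℝ

/-- Endowments `(a G^t, b G^t)` and dividends `D Gd^t`. -/
def growthEconomy (U : ℝ → ℝ → ℝ) (a b D G Gd : ℝ) : Economy where
  U := U
  young := fun t => a * G ^ t
  old := fun t => b * G ^ t
  dividend := fun t => D * Gd ^ t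

/-- A sequence of asset prices, asset holdings of the young, and consumption of the young and of
the old. -/
structure Path where
  /-- ex-dividend asset price -/
  P : ℕ → ℝ
  /-- asset holdings of the young -/
  x : ℕ → ℝ
  /-- consumption of the young -/
  y : ℕ → ℝ
  /-- consumption of the old -/
  z : ℕ → ℝ

/-- Rational expectations equilibrium. -/
structure IsEquilibrium (𝓔 : Economy) (E : Path) : Prop where
  price_pos : ∀ t, 0 < E.P t
  young_pos : ∀ t, 0 < E.y t
  old_pos : ∀ t, 0 < E.z t
  /-- the initial old own the unit supply of the asset and consume everything -/
  budget_initial_old : E.z 0 = 𝓔.old 0 + (E.P 0 + 𝓔.dividend 0) * 1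
  budget_young : ∀ t, E.y t + E.P t * E.x t = 𝓔.young t
  budget_old : ∀ t, E.z (t + 1) = 𝓔.old (t + 1) + (E.P (t + 1) + 𝓔.dividend (t + 1)) * E.x t
  /-- the holdings `x t` maximize utility among all holdings `h` that give a consumption plan in
  the domain of the utility function -/
  optimal : ∀ t h, 0 < 𝓔.young t - E.P t * h →
    0 < 𝓔.old (t + 1) + (E.P (t + 1) + 𝓔.dividend (t + 1)) * h →
    𝓔.U (𝓔.young t - E.P t * h)
      (𝓔.old (t + 1) + (E.P (t + 1) + 𝓔.dividend (t + 1)) * h) ≤ 𝓔.U (E.y t) (E.z (t + 1))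
  goods_clear : ∀ t, E.y t + E.z t = 𝓔.young t + 𝓔.old t + 𝓔.dividend t
  asset_clear : ∀ t, E.x t = 1

/-! ### Fundamental value and bubbles -/

/-- The gross risk-free rate `R_t` between `t` and `t + 1`. -/
noncomputable def grossRate (𝓔 : Economy) (E : Path) (t : ℕ) : ℝ :=
  (E.P (t + 1) + 𝓔.dividend (t + 1)) / E.P t

/-- The Arrow-Debreu (date-0) price `q_t = 1 / ∏_{s < t} R_s`. -/
noncomputable def adPrice (𝓔 : Economy) (E : Path) (t : ℕ) : ℝ :=
  1 / ∏ s ∈ Finset.range t, grossRate 𝓔 E s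

/-- The fundamental value `V_t = (1 / q_t) ∑_{s > t} q_s D_s`. The series converges along every
positive price path, see `summable_discounted_dividends`. -/
noncomputable def fundamentalValue (𝓔 : Economy) (E : Path) (t : ℕ) : ℝ :=
  1 / adPrice 𝓔 E t * ∑' k : ℕ, adPrice 𝓔 E (t + 1 + k) * 𝓔.dividend (t + 1 + k)

theorem adPrice_pos {𝓔 : Economy} {E : Path} (hP : ∀ t, 0 < E.P t)
    (hD : ∀ t, 0 ≤ 𝓔.dividend t) (t : ℕ) : 0 < adPrice 𝓔 E t := by
  unfold adPrice
  refine one_div_pos.mpr (Finset.prod_pos fun s _ => ?_)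
  exact div_pos (add_pos_of_pos_of_nonneg (hP _) (hD _)) (hP _)

theorem adPrice_succ_mul {𝓔 : Economy} {E : Path} (hP : ∀ t, 0 < E.P t)
    (hD : ∀ t, 0 ≤ 𝓔.dividend t) (t : ℕ) :
    adPrice 𝓔 E (t + 1) * (E.P (t + 1) + 𝓔.dividend (t + 1)) = adPrice 𝓔 E t * E.P t := by
  have h1 : 0 < E.P (t + 1) + 𝓔.dividend (t + 1) :=
    add_pos_of_pos_of_nonneg (hP _) (hD _)
  have h2 := hP t
  have h3 : 0 < ∏ s ∈ Finset.range t, grossRate 𝓔 E s :=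
    one_div_pos.mp (adPrice_pos hP hD t)
  unfold adPrice
  rw [Finset.prod_range_succ]
  rw [show grossRate 𝓔 E t = (E.P (t + 1) + 𝓔.dividend (t + 1)) / E.P t from rfl]
  field_simp

theorem summable_discounted_dividends {𝓔 : Economy} {E : Path} (hP : ∀ t, 0 < E.P t)
    (hD : ∀ t, 0 ≤ 𝓔.dividend t) (t : ℕ) :
    Summable fun k : ℕ => adPrice 𝓔 E (t + 1 + k) * 𝓔.dividend (t + 1 + k) := by
  have key : ∀ n : ℕ, ∑ k ∈ Finset.range n, adPrice 𝓔 E (t + 1 + k) * 𝓔.dividend (t + 1 + k)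
      = adPrice 𝓔 E t * E.P t - adPrice 𝓔 E (t + n) * E.P (t + n) := by
    intro n
    induction n with
    | zero => simp
    | succ n ih =>
      rw [Finset.sum_range_succ, ih, ← adPrice_succ_mul hP hD (t + n),
        show t + 1 + n = t + n + 1 by ring, show t + (n + 1) = t + n + 1 by ring]
      ring
  refine summable_of_sum_range_le (c := adPrice 𝓔 E t * E.P t)
    (fun k => mul_nonneg (adPrice_pos hP hD _).le (hD _)) fun n => ?_
  rw [key n]
  have := mul_pos (adPrice_pos hP hD (t + n)) (hP (t + n))
  linarith

/-- The asset price equals the fundamental value at every date. -/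
def IsFundamental (𝓔 : Economy) (E : Path) : Prop :=
  ∀ t, E.P t = fundamentalValue 𝓔 E t

/-- The asset price exceeds the fundamental value at every date. -/
def IsBubbly (𝓔 : Economy) (E : Path) : Prop :=
  ∀ t, fundamentalValue 𝓔 E t < E.P t

/-- `g^{-t} P_t` converges to a positive number. -/
def GrowsAtRate (g : ℝ) (E : Path) : Prop :=
  ∃ p : ℝ, 0 < p ∧ Tendsto (fun t => E.P t / g ^ t) atTop (𝓝 p)

/-- `g^{-t} P_t` converges to zero. -/
def NegligibleAtRate (g : ℝ) (E : Path) : Prop :=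
  Tendsto (fun t => E.P t / g ^ t) atTop (𝓝 0)

end OLG

/-!
By homogeneity the marginal rate of substitution depends only on the consumption ratio `ρ = z / y`,
and `M ρ = (U_y / U_z)(1, ρ)` is an increasing `C¹` bijection of the positive half-line
(`IsRegularUtility.isMRS`). With detrended prices `p_t = P_t / G ^ t`, dividends
`d_t = D (G_d / G) ^ t` and payoffs `s_t = p_t + d_t`, the first-order condition and market clearing
say that `p_t` and `s_{t+1}` are explicit functions of `ρ_t`, and the second is increasing. Hence
equilibria are exactly the positive solutions of a backward recursion
`p_t = φ (p_{t+1} + d_{t+1})`, where `φ = backPrice` is single-valued even when the forward dynamics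
is not; a solution known from some date on extends uniquely to all earlier dates. Moreover
`s = φ s * M ρ / G`, so the autarky return `M (G b / a)` governs small prices.

* If the autarky return exceeds `G_d`, compactness of the boxes `0 ≤ p_t ≤ C (G_d / G) ^ t` gives a
  solution that decays like dividends. The ratio `φ s / s` is decreasing and `φ` is increasing near
  zero, so two different solutions that tend to zero separate at least at the rate `l ^ t` with
  `l = M (G b / a) / G > G_d / G` (`IsMRS.exists_ge_of_ne_dividend_rate`). This yields uniqueness,
  and shows that all other negligible solutions have a summable dividend yield.
* `φ` has a fixed point where `M ρ = G`, if this `ρ` exceeds `G b / a`. If the derivative of `φ`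
  there is below `G / G_d` in modulus, backward iteration, which damps the geometrically decaying
  dividends, gives a solution that tends to the fixed point. Otherwise the modulus exceeds one and
  the forward recursion contracts (`exists_backwardOrbit_tendsto_fixedPoint`). No hyperbolicity of
  the fixed point is needed.
* If the autarky return is below `G_d`, a price close to zero would have to fall faster than
  dividends for ever, so prices stay away from zero (`IsMRS.exists_pos_le_of_autarky_lt`).
* If the autarky return lies strictly between `G_d` and `G`, the intermediate value theorem continues
  every price slightly above the fundamental solution forward to a solution that tends to zero, which
  gives an interval of equilibria (`IsBackwardOrbit.exists_forall_tendsto_zero`).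

A price path is bubbly when its dividend yield `D_t / P_t` is summable, and fundamental when the
yield is bounded away from zero, because `q_T P_T` is the product of the factors
`P_t / (P_t + D_t)` up to a constant.
-/

/-! ### Homogeneous utility and its marginal rate of substitution -/

namespace OLG

/-- The properties of the marginal rate of substitution `ρ ↦ (U_y / U_z)(1, ρ)`, as a function of
the consumption ratio `ρ = z / y`, on which the equilibrium analysis rests: it is an increasing
`C¹` bijection of the positive half-line. -/
structure IsMRS (M : ℝ → ℝ) : Prop where
  pos : ∀ ρ, 0 < ρ → 0 < M ρ
  strictMonoOn : StrictMonoOn M (Set.Ioi 0)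
  contDiffOn : ContDiffOn ℝ 1 M (Set.Ioi 0)
  surj : ∀ r, 0 < r → ∃ ρ, 0 < ρ ∧ M ρ = r

namespace IsRegularUtility

variable {U : ℝ → ℝ → ℝ}

lemma eq_mul_ratio (hU : IsRegularUtility U) {y z : ℝ} (hy : 0 < y) (hz : 0 < z) :
    U y z = y * U 1 (z / y) := by
  have h := hU.homogeneous y 1 (z / y) hy one_pos (div_pos hz hy)
  rwa [mul_one, mul_div_cancel₀ _ hy.ne'] at h

lemma contDiffOn_ratio (hU : IsRegularUtility U) : ContDiffOn ℝ 2 (U 1) (Set.Ioi 0) :=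
  hU.contDiffOn.comp (f := fun ρ : ℝ => ((1 : ℝ), ρ))
    (contDiff_const.prodMk contDiff_id).contDiffOn fun _ h => ⟨Set.mem_Ioi.2 one_pos, h⟩

lemma hasDerivAt_ratio (hU : IsRegularUtility U) {ρ : ℝ} (hρ : 0 < ρ) :
    HasDerivAt (U 1) (deriv (U 1) ρ) ρ :=
  ((hU.contDiffOn_ratio.contDiffAt (Ioi_mem_nhds hρ)).differentiableAt two_ne_zero).hasDerivAt

lemma contDiffOn_deriv_ratio (hU : IsRegularUtility U) :
    ContDiffOn ℝ 1 (deriv (U 1)) (Set.Ioi 0) :=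
  hU.contDiffOn_ratio.deriv_of_isOpen isOpen_Ioi (by norm_num)

lemma deriv_ratio_pos (hU : IsRegularUtility U) {ρ : ℝ} (hρ : 0 < ρ) : 0 < deriv (U 1) ρ :=
  hU.Uz_pos 1 ρ one_pos hρ

lemma deriv_deriv_ratio_neg (hU : IsRegularUtility U) {ρ : ℝ} (hρ : 0 < ρ) :
    deriv (deriv (U 1)) ρ < 0 :=
  hU.Uzz_neg 1 ρ one_pos hρ

lemma strictAntiOn_deriv_ratio (hU : IsRegularUtility U) :
    StrictAntiOn (deriv (U 1)) (Set.Ioi 0) :=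
  strictAntiOn_of_deriv_neg (convex_Ioi 0) hU.contDiffOn_deriv_ratio.continuousOn fun x hx =>
    hU.deriv_deriv_ratio_neg (by simpa using hx)

/-- Utility along a line in the open positive quadrant, differentiated through the representation
`U y z = y * U 1 (z / y)`. -/
lemma hasDerivAt_comp (hU : IsRegularUtility U) {y z : ℝ → ℝ} {y' z' s : ℝ}
    (hy : HasDerivAt y y' s) (hz : HasDerivAt z z' s) (hy0 : 0 < y s) (hz0 : 0 < z s) :
    HasDerivAt (fun s => U (y s) (z s))
      (y' * (U 1 (z s / y s) - z s / y s * deriv (U 1) (z s / y s))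
        + z' * deriv (U 1) (z s / y s)) s := by
  have h1 : HasDerivAt (fun s => y s * U 1 (z s / y s))
      (y' * U 1 (z s / y s)
        + y s * (deriv (U 1) (z s / y s) * ((z' * y s - z s * y') / y s ^ 2))) s :=
    hy.mul ((hU.hasDerivAt_ratio (div_pos hz0 hy0)).comp s (hz.div hy hy0.ne'))
  refine (h1.congr_of_eventuallyEq ?_).congr_deriv ?_
  · filter_upwards [hy.continuousAt.eventually (lt_mem_nhds hy0),
      hz.continuousAt.eventually (lt_mem_nhds hz0)] with t h1 h2
    exact hU.eq_mul_ratio h1 h2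
  · field_simp
    ring

lemma Uy_eq (hU : IsRegularUtility U) {y z : ℝ} (hy : 0 < y) (hz : 0 < z) :
    Uy U y z = U 1 (z / y) - z / y * deriv (U 1) (z / y) := by
  have := (hU.hasDerivAt_comp (hasDerivAt_id y) (hasDerivAt_const y z) hy hz).deriv
  simpa [Uy] using this

lemma mrs_one_eq (hU : IsRegularUtility U) {ρ : ℝ} (hρ : 0 < ρ) :
    mrs U 1 ρ = U 1 ρ / deriv (U 1) ρ - ρ := by
  have h := (hU.deriv_ratio_pos hρ).ne'
  have h2 : Uz U 1 ρ = deriv (U 1) ρ := rfl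
  rw [mrs, hU.Uy_eq one_pos hρ, h2, div_one]
  field_simp

/-- Concavity and homogeneity: the utility of any plan is at most its value at the supporting
prices `(U_y, U_z)` of the ray `z = ρ y`. -/
lemma le_supporting (hU : IsRegularUtility U) {y z ρ : ℝ} (hy : 0 < y) (hz : 0 < z)
    (hρ : 0 < ρ) : U y z ≤ y * (U 1 ρ - ρ * deriv (U 1) ρ) + z * deriv (U 1) ρ := by
  have hconc : StrictConcaveOn ℝ (Set.Ioi 0) (U 1) :=
    strictConcaveOn_of_deriv2_neg' (convex_Ioi 0) hU.contDiffOn_ratio.continuousOn fun x hx =>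
      hU.deriv_deriv_ratio_neg hx
  have key : ∀ x, 0 < x → U 1 x ≤ U 1 ρ + deriv (U 1) ρ * (x - ρ) := by
    intro x hx
    have hd := (hU.hasDerivAt_ratio hρ).differentiableAt
    rcases lt_trichotomy x ρ with h | h | h
    · have := hconc.concaveOn.deriv_le_slope hx hρ h hd
      rw [slope_def_field, le_div_iff₀ (by linarith)] at this
      linarith
    · simp [h]
    · have := hconc.concaveOn.slope_le_deriv hρ hx h hd
      rw [slope_def_field, div_le_iff₀ (by linarith)] at this
      linarith
  rw [hU.eq_mul_ratio hy hz]
  calc y * U 1 (z / y) ≤ y * (U 1 ρ + deriv (U 1) ρ * (z / y - ρ)) :=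
        mul_le_mul_of_nonneg_left (key _ (div_pos hz hy)) hy.le
    _ = _ := by field_simp; ring

theorem isMRS (hU : IsRegularUtility U) : IsMRS (mrs U 1) := by
  have hpos : ∀ ρ, 0 < ρ → 0 < mrs U 1 ρ := fun ρ hρ =>
    div_pos (hU.Uy_pos 1 ρ one_pos hρ) (hU.Uz_pos 1 ρ one_pos hρ)
  have hcd : ContDiffOn ℝ 1 (mrs U 1) (Set.Ioi 0) := by
    refine ContDiffOn.congr (f := fun ρ => U 1 ρ / deriv (U 1) ρ - ρ) ?_
      fun ρ hρ => hU.mrs_one_eq hρ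
    exact ((hU.contDiffOn_ratio.of_le (by norm_num)).div hU.contDiffOn_deriv_ratio
      fun ρ hρ => (hU.deriv_ratio_pos hρ).ne').sub contDiffOn_id
  refine ⟨hpos, ?_, hcd, ?_⟩
  · refine strictMonoOn_of_deriv_pos (convex_Ioi 0) hcd.continuousOn fun ρ hρ => ?_
    have hρ : 0 < ρ := by simpa using hρ
    have hd2 : HasDerivAt (deriv (U 1)) (deriv (deriv (U 1)) ρ) ρ :=
      ((hU.contDiffOn_deriv_ratio.contDiffAt (Ioi_mem_nhds hρ)).differentiableAt
        one_ne_zero).hasDerivAt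
    have h1 := hU.deriv_ratio_pos hρ
    have hd : HasDerivAt (mrs U 1)
        ((deriv (U 1) ρ * deriv (U 1) ρ - U 1 ρ * deriv (deriv (U 1)) ρ) / deriv (U 1) ρ ^ 2 - 1)
        ρ := by
      refine (((hU.hasDerivAt_ratio hρ).div hd2 h1.ne').sub
        (hasDerivAt_id ρ)).congr_of_eventuallyEq ?_
      filter_upwards [Ioi_mem_nhds hρ] with x hx
      exact hU.mrs_one_eq hx
    rw [hd.deriv, show (deriv (U 1) ρ * deriv (U 1) ρ - U 1 ρ * deriv (deriv (U 1)) ρ)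
      / deriv (U 1) ρ ^ 2 - 1 = U 1 ρ * (-deriv (deriv (U 1)) ρ) / deriv (U 1) ρ ^ 2 by
        field_simp; ring]
    have h2 := hU.deriv_deriv_ratio_neg hρ
    have h3 := hU.pos 1 ρ one_pos hρ
    exact div_pos (mul_pos h3 (by linarith)) (by positivity)
  · intro r hr
    -- near `0` the numerator `U_y` is bounded while `U_z` blows up
    obtain ⟨ρ₁, hρ₁, h1⟩ : ∃ ρ, 0 < ρ ∧ mrs U 1 ρ ≤ r := by
      have hev := (hU.inada_z 1 one_pos).eventually_ge_atTop (U 1 1 / r)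
      have hlt : ∀ᶠ ρ : ℝ in 𝓝[>] 0, ρ < 1 :=
        nhdsWithin_le_nhds (gt_mem_nhds (by norm_num))
      obtain ⟨ρ, h1, h2, h3⟩ := (hev.and (hlt.and self_mem_nhdsWithin)).exists
      have h3 : 0 < ρ := h3
      refine ⟨ρ, h3, ?_⟩
      have h4 : Uy U 1 ρ ≤ U 1 1 := by
        have := hU.le_supporting one_pos one_pos h3
        have h5 := hU.deriv_ratio_pos h3
        have hmono : StrictMonoOn (U 1) (Set.Ioi 0) :=
          strictMonoOn_of_deriv_pos (convex_Ioi 0) hU.contDiffOn_ratio.continuousOn fun x hx =>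
            hU.deriv_ratio_pos (by simpa using hx)
        have h6 := hmono h3 (Set.mem_Ioi.2 one_pos) h2
        rw [hU.Uy_eq one_pos h3, div_one]
        nlinarith [mul_pos h3 h5]
      rw [div_le_iff₀ hr] at h1
      rw [mrs, div_le_iff₀ (hU.Uz_pos 1 ρ one_pos h3)]
      linarith
    -- near infinity `U_z` is bounded while `U_y` blows up, by homogeneity of degree zero
    obtain ⟨ρ₂, hρ₂, h2⟩ : ∃ ρ, 0 < ρ ∧ r ≤ mrs U 1 ρ := by
      have hev := (hU.inada_y 1 one_pos).eventually_ge_atTop (r * deriv (U 1) 1)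
      have hlt : ∀ᶠ y : ℝ in 𝓝[>] 0, y < 1 :=
        nhdsWithin_le_nhds (gt_mem_nhds (by norm_num))
      obtain ⟨y, h1, h2, h3⟩ := (hev.and (hlt.and self_mem_nhdsWithin)).exists
      have h3 : 0 < y := h3
      have h4 : 0 < 1 / y := by positivity
      refine ⟨1 / y, h4, ?_⟩
      have h5 : deriv (U 1) (1 / y) ≤ deriv (U 1) 1 :=
        hU.strictAntiOn_deriv_ratio.antitoneOn (Set.mem_Ioi.2 one_pos) h4
          ((le_div_iff₀ h3).2 (by linarith))
      have h6 : Uz U 1 (1 / y) = deriv (U 1) (1 / y) := rfl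
      rw [mrs, le_div_iff₀ (hU.Uz_pos 1 _ one_pos h4), hU.Uy_eq one_pos h4, div_one, h6]
      rw [hU.Uy_eq h3 one_pos] at h1
      nlinarith
    obtain ⟨ρ, hρ, h⟩ := isPreconnected_Ioi.intermediate_value hρ₁ hρ₂ hcd.continuousOn ⟨h1, h2⟩
    exact ⟨ρ, hρ, h⟩

/-- The first-order condition is sufficient: a plan whose marginal rate of substitution equals the
relative price `S / P` is optimal on its budget line. -/
theorem le_of_mrs (hU : IsRegularUtility U) {y z y' z' P S : ℝ} (hy : 0 < y) (hz : 0 < z)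
    (hy' : 0 < y') (hz' : 0 < z') (hP : 0 < P) (hfoc : P * mrs U 1 (z / y) = S)
    (hbudget : S * y' + P * z' = S * y + P * z) : U y' z' ≤ U y z := by
  have hρ := div_pos hz hy
  have h1 := hU.deriv_ratio_pos hρ
  have h2 := hU.le_supporting hy' hz' hρ
  rw [hU.mrs_one_eq hρ] at hfoc
  rw [hU.eq_mul_ratio hy hz]
  have h3 : S * deriv (U 1) (z / y)
      = P * (U 1 (z / y) - z / y * deriv (U 1) (z / y)) := by
    rw [← hfoc]; field_simp
  have h4 : P * (y' * (U 1 (z / y) - z / y * deriv (U 1) (z / y)) + z' * deriv (U 1) (z / y))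
      = P * (y * U 1 (z / y)) := by
    have h5 : P * (y * U 1 (z / y))
        = y * (P * (U 1 (z / y) - z / y * deriv (U 1) (z / y)))
          + P * z * deriv (U 1) (z / y) := by field_simp; ring
    rw [h5, ← h3]
    linear_combination (-y') * h3 + deriv (U 1) (z / y) * hbudget
  exact h2.trans_eq (mul_left_cancel₀ hP.ne' h4)

/-- The first-order condition is necessary at an interior optimum. -/
theorem mrs_of_optimal (hU : IsRegularUtility U) {y₀ z₀ y z P S h₀ : ℝ} (hy : 0 < y) (hz : 0 < z)
    (hy₀ : y = y₀ - P * h₀) (hz₀ : z = z₀ + S * h₀)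
    (hopt : ∀ h, 0 < y₀ - P * h → 0 < z₀ + S * h → U (y₀ - P * h) (z₀ + S * h) ≤ U y z) :
    P * mrs U 1 (z / y) = S := by
  subst hy₀ hz₀
  have hdy : HasDerivAt (fun h : ℝ => y₀ - P * h) (-P) h₀ := by
    simpa using ((hasDerivAt_id h₀).const_mul P).const_sub y₀
  have hdz : HasDerivAt (fun h : ℝ => z₀ + S * h) S h₀ := by
    simpa using ((hasDerivAt_id h₀).const_mul S).const_add z₀
  have hmax : IsLocalMax (fun h => U (y₀ - P * h) (z₀ + S * h)) h₀ := by
    filter_upwards [hdy.continuousAt.eventually (lt_mem_nhds hy),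
      hdz.continuousAt.eventually (lt_mem_nhds hz)] with h h1 h2 using hopt h h1 h2
  have h0 := hmax.hasDerivAt_eq_zero (hU.hasDerivAt_comp hdy hdz hy hz)
  have hρ := div_pos hz hy
  have h1 := hU.deriv_ratio_pos hρ
  rw [hU.mrs_one_eq hρ]
  have h2 : U 1 ((z₀ + S * h₀) / (y₀ - P * h₀))
      / deriv (U 1) ((z₀ + S * h₀) / (y₀ - P * h₀)) * deriv (U 1)
        ((z₀ + S * h₀) / (y₀ - P * h₀)) = U 1 ((z₀ + S * h₀) / (y₀ - P * h₀)) :=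
    div_mul_cancel₀ _ h1.ne'
  refine mul_right_cancel₀ h1.ne' ?_
  linear_combination P * h2 - h0

end IsRegularUtility

end OLG

/-! ### Bubbles and the dividend yield -/

namespace OLG

section Bubbles

variable {𝓔 : Economy} {E : Path}

lemma sum_discounted_dividends (hP : ∀ t, 0 < E.P t) (hD : ∀ t, 0 ≤ 𝓔.dividend t) (t n : ℕ) :
    ∑ k ∈ Finset.range n, adPrice 𝓔 E (t + 1 + k) * 𝓔.dividend (t + 1 + k)
      = adPrice 𝓔 E t * E.P t - adPrice 𝓔 E (t + n) * E.P (t + n) := by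
  induction n with
  | zero => simp
  | succ n ih =>
    rw [Finset.sum_range_succ, ih, ← adPrice_succ_mul hP hD (t + n),
      show t + 1 + n = t + n + 1 by ring, show t + (n + 1) = t + n + 1 by ring]
    ring

/-- The bubble component of the price is `P_t - V_t = q_t⁻¹ lim_{T → ∞} q_T P_T`. -/
lemma fundamentalValue_eq_sub (hP : ∀ t, 0 < E.P t) (hD : ∀ t, 0 ≤ 𝓔.dividend t) {l : ℝ}
    (hl : Tendsto (fun t => adPrice 𝓔 E t * E.P t) atTop (𝓝 l)) (t : ℕ) :
    fundamentalValue 𝓔 E t = E.P t - l / adPrice 𝓔 E t := by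
  have hs := (summable_discounted_dividends hP hD t).hasSum.tendsto_sum_nat
  have h2 : Tendsto (fun n => ∑ k ∈ Finset.range n,
      adPrice 𝓔 E (t + 1 + k) * 𝓔.dividend (t + 1 + k)) atTop
      (𝓝 (adPrice 𝓔 E t * E.P t - l)) := by
    simp_rw [sum_discounted_dividends hP hD t]
    refine tendsto_const_nhds.sub ?_
    simpa only [add_comm] using (tendsto_add_atTop_iff_nat t).2 hl
  have hq := adPrice_pos hP hD t
  rw [fundamentalValue, tendsto_nhds_unique hs h2]
  field_simp

lemma antitone_adPrice_mul (hP : ∀ t, 0 < E.P t) (hD : ∀ t, 0 ≤ 𝓔.dividend t) :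
    Antitone fun t => adPrice 𝓔 E t * E.P t := by
  refine antitone_nat_of_succ_le fun t => ?_
  rw [← adPrice_succ_mul hP hD t]
  have := mul_nonneg (adPrice_pos hP hD (t + 1)).le (hD (t + 1))
  linarith

/-- A summable dividend yield makes the asset bubbly. -/
theorem isBubbly_of_summable_yield (hP : ∀ t, 0 < E.P t) (hD : ∀ t, 0 ≤ 𝓔.dividend t)
    (hsum : Summable fun t => 𝓔.dividend t / E.P t) : IsBubbly 𝓔 E := by
  set u : ℕ → ℝ := fun t => adPrice 𝓔 E t * E.P t with hu
  have hupos : ∀ t, 0 < u t := fun t => mul_pos (adPrice_pos hP hD t) (hP t)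
  have hterm : ∀ t, 0 ≤ 𝓔.dividend t / E.P t := fun t => div_nonneg (hD t) (hP t).le
  -- `q_t P_t = q_{t+1} P_{t+1} (1 + D_{t+1} / P_{t+1})`, and `1 + x ≤ exp x`
  have hstep : ∀ t, u 0 ≤ u t * Real.exp (∑ s ∈ Finset.range (t + 1), 𝓔.dividend s / E.P s) := by
    intro t
    induction t with
    | zero => exact le_mul_of_one_le_right (hupos 0).le (Real.one_le_exp (by simpa using hterm 0))
    | succ t ih =>
      refine ih.trans ?_
      rw [Finset.sum_range_succ _ (t + 1), add_comm (∑ s ∈ Finset.range (t + 1), _), Real.exp_add,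
        ← mul_assoc]
      refine mul_le_mul_of_nonneg_right ?_ (Real.exp_pos _).le
      have h1 : u t = u (t + 1) * (𝓔.dividend (t + 1) / E.P (t + 1) + 1) := by
        simp only [hu]
        rw [← adPrice_succ_mul hP hD t]
        have := (hP (t + 1)).ne'
        field_simp
        ring
      rw [h1]
      exact mul_le_mul_of_nonneg_left (Real.add_one_le_exp _) (hupos _).le
  set S := ∑' t, 𝓔.dividend t / E.P t
  have hlow : ∀ t, u 0 / Real.exp S ≤ u t := by
    intro t
    rw [div_le_iff₀ (Real.exp_pos _)]
    refine (hstep t).trans (mul_le_mul_of_nonneg_left ?_ (hupos t).le)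
    exact Real.exp_le_exp.2 (hsum.sum_le_tsum _ fun s _ => hterm s)
  have hanti := antitone_adPrice_mul hP hD
  have hl := tendsto_atTop_ciInf hanti ⟨0, by rintro _ ⟨t, rfl⟩; exact (hupos t).le⟩
  have hlpos : 0 < ⨅ t, adPrice 𝓔 E t * E.P t :=
    (div_pos (hupos 0) (Real.exp_pos S)).trans_le (le_ciInf hlow)
  intro t
  rw [fundamentalValue_eq_sub hP hD hl t]
  have := div_pos hlpos (adPrice_pos hP hD t)
  linarith

/-- A dividend yield bounded away from zero makes the price fundamental. -/
theorem isFundamental_of_yield_ge (hP : ∀ t, 0 < E.P t) (hD : ∀ t, 0 ≤ 𝓔.dividend t) {c : ℝ}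
    (hc : 0 < c) (hyield : ∀ t, c * E.P t ≤ 𝓔.dividend t) : IsFundamental 𝓔 E := by
  set u : ℕ → ℝ := fun t => adPrice 𝓔 E t * E.P t with hu
  have hupos : ∀ t, 0 < u t := fun t => mul_pos (adPrice_pos hP hD t) (hP t)
  have hgeom : ∀ t, u t ≤ u 0 * (1 / (1 + c)) ^ t := by
    intro t
    induction t with
    | zero => simp
    | succ t ih =>
      have h1 : u (t + 1) * (1 + c) ≤ u t := by
        simp only [hu]
        rw [← adPrice_succ_mul hP hD t, mul_assoc]
        refine mul_le_mul_of_nonneg_left ?_ (adPrice_pos hP hD _).le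
        linarith [hyield (t + 1)]
      rw [pow_succ, ← mul_assoc, mul_one_div, le_div_iff₀ (by positivity)]
      exact h1.trans ih
  have hl : Tendsto (fun t => adPrice 𝓔 E t * E.P t) atTop (𝓝 0) := by
    refine squeeze_zero (fun t => (hupos t).le) hgeom ?_
    simpa using (tendsto_pow_atTop_nhds_zero_of_lt_one (r := 1 / (1 + c)) (by positivity)
      ((div_lt_one (by positivity)).2 (by linarith))).const_mul (u 0)
  intro t
  rw [fundamentalValue_eq_sub hP hD hl t]
  simp

end Bubbles

end OLG

/-! ### The backward price map -/

namespace OLG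

/-- The detrended price of the asset when the consumption ratio of the current generation is `ρ`,
obtained from the goods market and the first-order condition. It is positive exactly when `ρ`
exceeds its autarky value `G * b / a`. -/
noncomputable def ratioPrice (M : ℝ → ℝ) (a b G ρ : ℝ) : ℝ := (a * ρ - G * b) / (ρ + M ρ)

/-- The detrended payoff of the asset (price plus dividend) in the next period when the consumption
ratio of the current generation is `ρ`. -/
noncomputable def ratioPayoff (M : ℝ → ℝ) (a b G ρ : ℝ) : ℝ := M ρ * ratioPrice M a b G ρ / G

/-- The consumption ratio that corresponds to the next-period payoff `s > 0`, the inverse of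
`ratioPayoff` above the autarky ratio. -/
noncomputable def payoffRatio (M : ℝ → ℝ) (a b G s : ℝ) : ℝ :=
  Function.invFunOn (ratioPayoff M a b G) (Set.Ioi (G * b / a)) s

/-- The backward price map: the only detrended price today that is compatible with the detrended
payoff `s > 0` tomorrow. -/
noncomputable def backPrice (M : ℝ → ℝ) (a b G s : ℝ) : ℝ :=
  ratioPrice M a b G (payoffRatio M a b G s)

namespace IsMRS

variable {M : ℝ → ℝ} {a b G : ℝ}

lemma continuousAt (hM : IsMRS M) {ρ : ℝ} (hρ : 0 < ρ) : ContinuousAt M ρ :=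
  hM.contDiffOn.continuousOn.continuousAt (Ioi_mem_nhds hρ)

lemma hasDerivAt (hM : IsMRS M) {ρ : ℝ} (hρ : 0 < ρ) : HasDerivAt M (deriv M ρ) ρ :=
  ((hM.contDiffOn.contDiffAt (Ioi_mem_nhds hρ)).differentiableAt one_ne_zero).hasDerivAt

lemma deriv_nonneg (hM : IsMRS M) {ρ : ℝ} (hρ : 0 < ρ) : 0 ≤ deriv M ρ := by
  rw [← derivWithin_of_isOpen isOpen_Ioi (Set.mem_Ioi.2 hρ)]
  exact hM.strictMonoOn.monotoneOn.derivWithin_nonneg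

lemma ratio_pos (ha : 0 < a) (hb : 0 ≤ b) (hG : 0 < G) {ρ : ℝ} (hρ : G * b / a < ρ) : 0 < ρ :=
  (by positivity : 0 ≤ G * b / a).trans_lt hρ

lemma ratioPrice_pos (hM : IsMRS M) (ha : 0 < a) (hb : 0 ≤ b) (hG : 0 < G) {ρ : ℝ}
    (hρ : G * b / a < ρ) : 0 < ratioPrice M a b G ρ := by
  have h0 := ratio_pos ha hb hG hρ
  rw [div_lt_iff₀ ha] at hρ
  exact div_pos (by linarith) (add_pos h0 (hM.pos ρ h0))

lemma ratioPrice_lt (hM : IsMRS M) (ha : 0 < a) (hb : 0 ≤ b) (hG : 0 < G) {ρ : ℝ}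
    (hρ : G * b / a < ρ) : ratioPrice M a b G ρ < a := by
  have h0 := ratio_pos ha hb hG hρ
  have h1 := hM.pos ρ h0
  rw [ratioPrice, div_lt_iff₀ (by positivity)]
  nlinarith [mul_pos ha h1, mul_nonneg hG.le hb]

lemma ratioPayoff_pos (hM : IsMRS M) (ha : 0 < a) (hb : 0 ≤ b) (hG : 0 < G) {ρ : ℝ}
    (hρ : G * b / a < ρ) : 0 < ratioPayoff M a b G ρ :=
  div_pos (mul_pos (hM.pos ρ (ratio_pos ha hb hG hρ)) (hM.ratioPrice_pos ha hb hG hρ)) hG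

lemma hasDerivAt_ratioPrice (hM : IsMRS M) {ρ : ℝ} (hρ : 0 < ρ) :
    HasDerivAt (ratioPrice M a b G)
      ((a * (ρ + M ρ) - (a * ρ - G * b) * (1 + deriv M ρ)) / (ρ + M ρ) ^ 2) ρ := by
  have h1 : HasDerivAt (fun ρ => a * ρ - G * b) a ρ := by
    simpa using ((hasDerivAt_id ρ).const_mul a).sub_const (G * b)
  exact h1.div ((hasDerivAt_id ρ).add (hM.hasDerivAt hρ)) (add_pos hρ (hM.pos ρ hρ)).ne'

lemma exists_hasDerivAt_ratioPayoff (hM : IsMRS M) (ha : 0 < a) (hb : 0 ≤ b) (hG : 0 < G) {ρ : ℝ}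
    (hρ : G * b / a < ρ) : ∃ v, 0 < v ∧ HasDerivAt (ratioPayoff M a b G) v ρ := by
  have h0 := ratio_pos ha hb hG hρ
  have h1 := hM.pos ρ h0
  have h2 := hM.deriv_nonneg h0
  refine ⟨_, ?_, ((hM.hasDerivAt h0).mul (hM.hasDerivAt_ratioPrice h0)).div_const G⟩
  rw [div_lt_iff₀ ha] at hρ
  refine div_pos ?_ hG
  have h3 : deriv M ρ * ratioPrice M a b G ρ
      + M ρ * ((a * (ρ + M ρ) - (a * ρ - G * b) * (1 + deriv M ρ)) / (ρ + M ρ) ^ 2)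
      = (deriv M ρ * (a * ρ - G * b) * ρ + M ρ * (a * M ρ + G * b)) / (ρ + M ρ) ^ 2 := by
    have : ρ + M ρ ≠ 0 := (add_pos h0 h1).ne'
    rw [ratioPrice]
    field_simp
    ring
  rw [h3]
  have h4 : 0 ≤ deriv M ρ * (a * ρ - G * b) * ρ :=
    mul_nonneg (mul_nonneg h2 (by linarith)) h0.le
  have h5 : 0 < M ρ * (a * M ρ + G * b) := by positivity
  exact div_pos (by linarith) (by positivity)

lemma continuousOn_ratioPayoff (hM : IsMRS M) (ha : 0 < a) (hb : 0 ≤ b) (hG : 0 < G) :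
    ContinuousOn (ratioPayoff M a b G) (Set.Ioi (G * b / a)) := fun ρ hρ => by
  obtain ⟨v, -, hv⟩ := hM.exists_hasDerivAt_ratioPayoff ha hb hG hρ
  exact hv.continuousAt.continuousWithinAt

lemma strictMonoOn_ratioPayoff (hM : IsMRS M) (ha : 0 < a) (hb : 0 ≤ b) (hG : 0 < G) :
    StrictMonoOn (ratioPayoff M a b G) (Set.Ioi (G * b / a)) := by
  refine strictMonoOn_of_deriv_pos (convex_Ioi _) (hM.continuousOn_ratioPayoff ha hb hG) ?_
  intro ρ hρ
  obtain ⟨v, hv0, hv⟩ := hM.exists_hasDerivAt_ratioPayoff ha hb hG (by simpa using hρ)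
  rwa [hv.deriv]

lemma exists_ratioPayoff_eq (hM : IsMRS M) (ha : 0 < a) (hb : 0 ≤ b) (hG : 0 < G) {s : ℝ}
    (hs : 0 < s) : ∃ ρ ∈ Set.Ioi (G * b / a), ratioPayoff M a b G ρ = s := by
  have hc : 0 ≤ G * b / a := by positivity
  have hsa : 0 < G * s / a := by positivity
  -- the payoff is at most `(a ρ - G b) / G`
  obtain ⟨ρ₁, hρ₁, h1⟩ : ∃ ρ, G * b / a < ρ ∧ ratioPayoff M a b G ρ ≤ s := by
    have hρ : G * b / a < G * b / a + G * s / a := by linarith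
    refine ⟨_, hρ, ?_⟩
    have h0 := ratio_pos ha hb hG hρ
    have h1 := hM.pos _ h0
    set ρ := G * b / a + G * s / a with hρdef
    have h2 : a * ρ - G * b = G * s := by rw [hρdef]; field_simp; ring
    rw [ratioPayoff, ratioPrice, h2, div_le_iff₀ hG, ← mul_div_assoc,
      div_le_iff₀ (by positivity)]
    nlinarith [mul_pos hG hs, mul_pos (mul_pos hG hs) h0]
  -- for large `ρ` it is at least `(a / 4 G) min ρ (M ρ)`
  obtain ⟨ρ₂, hρ₂, h2⟩ : ∃ ρ, G * b / a < ρ ∧ s ≤ ratioPayoff M a b G ρ := by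
    obtain ⟨r, hr, hMr⟩ := hM.surj (4 * (G * s / a)) (by positivity)
    set ρ := r + 4 * (G * s / a) + 2 * (G * b / a) with hρdef
    have hρ : G * b / a < ρ := by linarith
    have h0 := ratio_pos ha hb hG hρ
    refine ⟨ρ, hρ, ?_⟩
    have h1 : 4 * (G * s / a) ≤ M ρ := by
      rw [← hMr]; exact hM.strictMonoOn.monotoneOn hr h0 (by linarith)
    have h2 : 4 * (G * s / a) ≤ ρ := by linarith
    have h3 := hM.pos _ h0
    have h4 : ρ / 2 ≤ ρ - G * b / a := by linarith
    have h5 : a * ρ - G * b = a * (ρ - G * b / a) := by field_simp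
    have h6 : s = a * (G * s / a) / G := by field_simp
    rw [ratioPayoff, ratioPrice, h5, h6, ← mul_div_assoc (M ρ)]
    refine div_le_div_of_nonneg_right ?_ hG.le
    rw [le_div_iff₀ (by positivity)]
    have h7 : (G * s / a) * (ρ + M ρ) ≤ M ρ * (ρ / 2) := by nlinarith
    have h8 : M ρ * (ρ / 2) ≤ M ρ * (ρ - G * b / a) := mul_le_mul_of_nonneg_left h4 h3.le
    nlinarith
  obtain ⟨ρ, hρ, h⟩ := isPreconnected_Ioi.intermediate_value hρ₁ hρ₂
    (hM.continuousOn_ratioPayoff ha hb hG) ⟨h1, h2⟩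
  exact ⟨ρ, hρ, h⟩

lemma lt_payoffRatio (hM : IsMRS M) (ha : 0 < a) (hb : 0 ≤ b) (hG : 0 < G) {s : ℝ} (hs : 0 < s) :
    G * b / a < payoffRatio M a b G s :=
  Function.invFunOn_mem (hM.exists_ratioPayoff_eq ha hb hG hs)

lemma payoffRatio_pos (hM : IsMRS M) (ha : 0 < a) (hb : 0 ≤ b) (hG : 0 < G) {s : ℝ}
    (hs : 0 < s) : 0 < payoffRatio M a b G s :=
  ratio_pos ha hb hG (hM.lt_payoffRatio ha hb hG hs)

lemma ratioPayoff_payoffRatio (hM : IsMRS M) (ha : 0 < a) (hb : 0 ≤ b) (hG : 0 < G) {s : ℝ}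
    (hs : 0 < s) : ratioPayoff M a b G (payoffRatio M a b G s) = s :=
  Function.invFunOn_eq (hM.exists_ratioPayoff_eq ha hb hG hs)

lemma payoffRatio_ratioPayoff (hM : IsMRS M) (ha : 0 < a) (hb : 0 ≤ b) (hG : 0 < G) {ρ : ℝ}
    (hρ : G * b / a < ρ) : payoffRatio M a b G (ratioPayoff M a b G ρ) = ρ := by
  have hs := hM.ratioPayoff_pos ha hb hG hρ
  exact (hM.strictMonoOn_ratioPayoff ha hb hG).injOn (hM.lt_payoffRatio ha hb hG hs) hρ
    (hM.ratioPayoff_payoffRatio ha hb hG hs)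

lemma strictMonoOn_payoffRatio (hM : IsMRS M) (ha : 0 < a) (hb : 0 ≤ b) (hG : 0 < G) :
    StrictMonoOn (payoffRatio M a b G) (Set.Ioi 0) := by
  intro s hs s' hs' h
  rwa [← (hM.strictMonoOn_ratioPayoff ha hb hG).lt_iff_lt (hM.lt_payoffRatio ha hb hG hs)
    (hM.lt_payoffRatio ha hb hG hs'), hM.ratioPayoff_payoffRatio ha hb hG hs,
    hM.ratioPayoff_payoffRatio ha hb hG hs']

/-- A payoff below the one at `ρ` comes from a ratio below `ρ`. -/
lemma payoffRatio_le (hM : IsMRS M) (ha : 0 < a) (hb : 0 ≤ b) (hG : 0 < G) {s ρ : ℝ}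
    (hs : 0 < s) (hρ : G * b / a < ρ) (h : s ≤ ratioPayoff M a b G ρ) :
    payoffRatio M a b G s ≤ ρ := by
  rw [← hM.payoffRatio_ratioPayoff ha hb hG hρ]
  exact (hM.strictMonoOn_payoffRatio ha hb hG).monotoneOn hs (hM.ratioPayoff_pos ha hb hG hρ) h

lemma continuousAt_payoffRatio (hM : IsMRS M) (ha : 0 < a) (hb : 0 ≤ b) (hG : 0 < G) {s : ℝ}
    (hs : 0 < s) : ContinuousAt (payoffRatio M a b G) s := by
  refine continuousAt_of_monotoneOn_of_image_mem_nhds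
    (hM.strictMonoOn_payoffRatio ha hb hG).monotoneOn (Ioi_mem_nhds hs) ?_
  filter_upwards [Ioi_mem_nhds (hM.lt_payoffRatio ha hb hG hs)] with ρ hρ
  exact ⟨_, hM.ratioPayoff_pos ha hb hG hρ, hM.payoffRatio_ratioPayoff ha hb hG hρ⟩

lemma differentiableAt_backPrice (hM : IsMRS M) (ha : 0 < a) (hb : 0 ≤ b) (hG : 0 < G) {s : ℝ}
    (hs : 0 < s) : DifferentiableAt ℝ (backPrice M a b G) s := by
  obtain ⟨v, hv0, hv⟩ :=
    hM.exists_hasDerivAt_ratioPayoff ha hb hG (hM.lt_payoffRatio ha hb hG hs)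
  have h1 : HasDerivAt (payoffRatio M a b G) v⁻¹ s := by
    refine HasDerivAt.of_local_left_inverse (hM.continuousAt_payoffRatio ha hb hG hs) hv hv0.ne' ?_
    filter_upwards [Ioi_mem_nhds hs] with x hx using hM.ratioPayoff_payoffRatio ha hb hG hx
  exact ((hM.hasDerivAt_ratioPrice (hM.payoffRatio_pos ha hb hG hs)).comp s h1).differentiableAt

lemma continuousOn_backPrice (hM : IsMRS M) (ha : 0 < a) (hb : 0 ≤ b) (hG : 0 < G) :
    ContinuousOn (backPrice M a b G) (Set.Ioi 0) := fun _ hs =>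
  (hM.differentiableAt_backPrice ha hb hG hs).continuousAt.continuousWithinAt

lemma backPrice_pos (hM : IsMRS M) (ha : 0 < a) (hb : 0 ≤ b) (hG : 0 < G) {s : ℝ} (hs : 0 < s) :
    0 < backPrice M a b G s :=
  hM.ratioPrice_pos ha hb hG (hM.lt_payoffRatio ha hb hG hs)

lemma backPrice_lt (hM : IsMRS M) (ha : 0 < a) (hb : 0 ≤ b) (hG : 0 < G) {s : ℝ} (hs : 0 < s) :
    backPrice M a b G s < a :=
  hM.ratioPrice_lt ha hb hG (hM.lt_payoffRatio ha hb hG hs)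

/-- The return on the asset equals the marginal rate of substitution. -/
lemma backPrice_mul (hM : IsMRS M) (ha : 0 < a) (hb : 0 ≤ b) (hG : 0 < G) {s : ℝ} (hs : 0 < s) :
    backPrice M a b G s * M (payoffRatio M a b G s) = G * s := by
  have h := hM.ratioPayoff_payoffRatio ha hb hG hs
  rw [ratioPayoff, div_eq_iff hG.ne'] at h
  rw [backPrice, mul_comm, h, mul_comm]

/-- The first-order condition of the young, in detrended variables, determines the price today as a
function of the payoff tomorrow. -/
lemma foc_iff_eq_backPrice (hM : IsMRS M) (ha : 0 < a) (hb : 0 ≤ b) (hG : 0 < G) {p s : ℝ}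
    (hp : 0 < p) (hpa : p < a) (hs : 0 < s) :
    p * M (G * (b + s) / (a - p)) = G * s ↔ p = backPrice M a b G s := by
  have hap : 0 < a - p := by linarith
  constructor
  · intro h
    set ρ := G * (b + s) / (a - p) with hρdef
    have h1 : ρ * (a - p) = G * b + p * M ρ := by
      rw [h, hρdef]; field_simp
    have hρ0 : 0 < ρ := by positivity
    have hρM := hM.pos ρ hρ0
    have hρ : G * b / a < ρ := by
      rw [div_lt_iff₀ ha]
      nlinarith [mul_pos hp hρM, mul_pos hρ0 hp]
    have h2 : ratioPrice M a b G ρ = p := by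
      rw [ratioPrice, div_eq_iff (by positivity)]
      linarith
    have h3 : ratioPayoff M a b G ρ = s := by
      rw [ratioPayoff, h2, div_eq_iff hG.ne']
      linarith
    rw [backPrice, ← h3, hM.payoffRatio_ratioPayoff ha hb hG hρ, h2]
  · intro h
    have h1 := hM.backPrice_mul ha hb hG hs
    rw [← h] at h1
    have hρ0 := hM.payoffRatio_pos ha hb hG hs
    set ρ := payoffRatio M a b G s
    have h2 : p * (ρ + M ρ) = a * ρ - G * b := by
      rw [h, backPrice, ratioPrice, div_mul_cancel₀]
      exact (add_pos hρ0 (hM.pos ρ hρ0)).ne'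
    have h3 : G * (b + s) / (a - p) = ρ := by
      rw [div_eq_iff hap.ne']
      linarith
    rw [h3, h1]

/-- At the ratio where the marginal rate of substitution equals the growth rate, the price is a
fixed point of the backward price map. -/
lemma backPrice_ratioPrice (hM : IsMRS M) (ha : 0 < a) (hb : 0 ≤ b) (hG : 0 < G) {ρ : ℝ}
    (hρ : G * b / a < ρ) (hMρ : M ρ = G) :
    backPrice M a b G (ratioPrice M a b G ρ) = ratioPrice M a b G ρ := by
  have h : ratioPayoff M a b G ρ = ratioPrice M a b G ρ := by
    rw [ratioPayoff, hMρ]; field_simp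
  conv_lhs => rw [← h, backPrice, hM.payoffRatio_ratioPayoff ha hb hG hρ]

/-- If the ratio is at most `ρ₁`, the price is at least `G / M ρ₁` times the payoff. -/
lemma le_mul_backPrice (hM : IsMRS M) (ha : 0 < a) (hb : 0 ≤ b) (hG : 0 < G) {s ρ₁ θ : ℝ}
    (hs : 0 < s) (hle : payoffRatio M a b G s ≤ ρ₁) (hθ : M ρ₁ ≤ G * θ) :
    s ≤ θ * backPrice M a b G s := by
  have h1 := hM.backPrice_mul ha hb hG hs
  have h2 := hM.payoffRatio_pos ha hb hG hs
  have h3 : M (payoffRatio M a b G s) ≤ M ρ₁ :=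
    hM.strictMonoOn.monotoneOn h2 (h2.trans_le hle) hle
  have h4 := hM.backPrice_pos ha hb hG hs
  nlinarith [mul_le_mul_of_nonneg_left (h3.trans hθ) h4.le]

/-- The return on the asset is at least the autarky return. -/
lemma mul_backPrice_le (hM : IsMRS M) (ha : 0 < a) (hb : 0 < b) (hG : 0 < G) {s : ℝ}
    (hs : 0 < s) : M (G * b / a) / G * backPrice M a b G s ≤ s := by
  have h1 := hM.backPrice_mul ha hb.le hG hs
  have h2 := hM.lt_payoffRatio ha hb.le hG hs
  have h0 : 0 < G * b / a := by positivity
  have h3 := hM.strictMonoOn.monotoneOn (Set.mem_Ioi.2 h0) (Set.mem_Ioi.2 (h0.trans h2)) h2.le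
  have h4 := hM.backPrice_pos ha hb.le hG hs
  rw [div_mul_eq_mul_div, div_le_iff₀ hG]
  nlinarith [mul_le_mul_of_nonneg_left h3 h4.le]

/-- The ratio of price to payoff decreases with the payoff, which bounds the slope of the backward
price map from above, without any condition on the sign of the slope. -/
lemma mul_backPrice_sub_le (hM : IsMRS M) (ha : 0 < a) (hb : 0 < b) (hG : 0 < G) {s s' : ℝ}
    (hs : 0 < s) (hss' : s ≤ s') :
    M (G * b / a) / G * (backPrice M a b G s' - backPrice M a b G s) ≤ s' - s := by
  have hs' := hs.trans_le hss'
  have h1 := hM.backPrice_mul ha hb.le hG hs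
  have h1' := hM.backPrice_mul ha hb.le hG hs'
  have hp := hM.backPrice_pos ha hb.le hG hs
  have hr := hM.payoffRatio_pos ha hb.le hG hs
  have hM0 := hM.pos _ hr
  have hmono := hM.strictMonoOn.monotoneOn hr (hM.payoffRatio_pos ha hb.le hG hs')
    ((hM.strictMonoOn_payoffRatio ha hb.le hG).monotoneOn hs hs' hss')
  have hp' := hM.backPrice_pos ha hb.le hG hs'
  have hlow := hM.mul_backPrice_le ha hb hG hs
  have hl : 0 < M (G * b / a) / G := div_pos (hM.pos _ (by positivity)) hG
  have h2 : backPrice M a b G s' * s ≤ backPrice M a b G s * s' := by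
    have h3 : backPrice M a b G s' * M (payoffRatio M a b G s) ≤ G * s' := by
      rw [← h1']; exact mul_le_mul_of_nonneg_left hmono hp'.le
    have h4 : G * (backPrice M a b G s' * s) ≤ G * (backPrice M a b G s * s') := by
      nlinarith [mul_le_mul_of_nonneg_right h3 hp.le]
    exact le_of_mul_le_mul_left h4 hG
  set l := M (G * b / a) / G
  have h3 : (backPrice M a b G s' - backPrice M a b G s) * s
      ≤ backPrice M a b G s * (s' - s) := by linarith
  have h4 : l * (backPrice M a b G s' - backPrice M a b G s) * s ≤ (s' - s) * s := by
    calc _ = l * ((backPrice M a b G s' - backPrice M a b G s) * s) := by ring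
      _ ≤ l * (backPrice M a b G s * (s' - s)) := mul_le_mul_of_nonneg_left h3 hl.le
      _ = l * backPrice M a b G s * (s' - s) := by ring
      _ ≤ s * (s' - s) := mul_le_mul_of_nonneg_right hlow (by linarith)
      _ = _ := by ring
  exact le_of_mul_le_mul_right h4 hs

/-- For small payoffs the backward price map is increasing, because the marginal rate of
substitution is Lipschitz near the autarky ratio. -/
lemma exists_monotoneOn_backPrice (hM : IsMRS M) (ha : 0 < a) (hb : 0 < b) (hG : 0 < G) :
    ∃ r, 0 < r ∧ MonotoneOn (backPrice M a b G) (Set.Ioc 0 r) := by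
  have h0 : 0 < G * b / a := by positivity
  set c := G * b / a with hc
  obtain ⟨K, t, ht, hK⟩ :=
    (hM.contDiffOn.contDiffAt (Ioi_mem_nhds h0)).exists_lipschitzOnWith
  obtain ⟨ε, hε, hball⟩ := Metric.mem_nhds_iff.1 ht
  have hMc := hM.pos c h0
  have hK0 : 0 < 1 + (K : ℝ) := by positivity
  set δ := min (ε / 2) (M c / (1 + K)) with hδ
  have hδ0 : 0 < δ := lt_min (by positivity) (by positivity)
  have hcδ : c < c + δ := by linarith
  refine ⟨ratioPayoff M a b G (c + δ), hM.ratioPayoff_pos ha hb.le hG hcδ, ?_⟩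
  intro s hs s' hs' hss'
  have hρ := hM.lt_payoffRatio ha hb.le hG hs.1
  have hρ' := hM.payoffRatio_le ha hb.le hG hs'.1 hcδ hs'.2
  have hle := (hM.strictMonoOn_payoffRatio ha hb.le hG).monotoneOn hs.1 hs'.1 hss'
  rw [backPrice, backPrice]
  set ρ := payoffRatio M a b G s
  set ρ' := payoffRatio M a b G s'
  rw [← hc] at hρ
  have hmem : ∀ x, c < x → x ≤ c + δ → x ∈ t := fun x h1 h2 => hball (by
    rw [Metric.mem_ball, Real.dist_eq, abs_of_pos (by linarith)]
    have := min_le_left (ε / 2) (M c / (1 + K))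
    linarith)
  have hlip := hK.dist_le_mul ρ' (hmem _ (hρ.trans_le hle) hρ') ρ (hmem _ hρ (hle.trans hρ'))
  rw [Real.dist_eq, Real.dist_eq, abs_of_nonneg (sub_nonneg.2 hle)] at hlip
  have hlip := (le_abs_self _).trans hlip
  have hMρ : M c ≤ M ρ := hM.strictMonoOn.monotoneOn h0 (h0.trans hρ) hρ.le
  have hδ2 : (ρ - c) * (1 + K) ≤ M c := by
    rw [← le_div_iff₀ hK0]
    have := min_le_right (ε / 2) (M c / (1 + K))
    linarith
  have hρ0 := h0.trans hρ
  have hρ0' := hρ0.trans_le hle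
  have hGb : G * b = a * c := by rw [hc]; field_simp
  rw [ratioPrice, ratioPrice, hGb, div_le_div_iff₀ (add_pos hρ0 (hM.pos _ hρ0))
    (add_pos hρ0' (hM.pos _ hρ0'))]
  have h1 : (ρ - c) * (M ρ' - M ρ) ≤ (ρ - c) * (K * (ρ' - ρ)) :=
    mul_le_mul_of_nonneg_left hlip (by linarith)
  have h2 : (ρ - c) * (1 + K) * (ρ' - ρ) ≤ (ρ + M ρ) * (ρ' - ρ) :=
    mul_le_mul_of_nonneg_right (by linarith) (by linarith)
  have h3 : (ρ - c) * (ρ' + M ρ') ≤ (ρ' - c) * (ρ + M ρ) := by nlinarith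
  calc (a * ρ - a * c) * (ρ' + M ρ') = a * ((ρ - c) * (ρ' + M ρ')) := by ring
    _ ≤ a * ((ρ' - c) * (ρ + M ρ)) := mul_le_mul_of_nonneg_left h3 ha.le
    _ = _ := by ring

end IsMRS

end OLG

/-! ### Positive solutions of backward recursions -/

namespace OLG

/-- A positive sequence that solves the backward recursion `p_t = φ (p_{t+1} + d_{t+1})`. -/
def IsBackwardOrbit (φ : ℝ → ℝ) (d p : ℕ → ℝ) : Prop :=
  ∀ t, 0 < p t ∧ p t = φ (p (t + 1) + d (t + 1))

section Orbits

variable {φ : ℝ → ℝ} {d : ℕ → ℝ}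

/-- A solution from date `T` on extends to the earlier dates. -/
lemma exists_backwardOrbit_of_tail (hφ : ∀ s, 0 < s → 0 < φ s) (hd : ∀ t, 0 < d t) (T : ℕ) :
    ∀ x : ℕ → ℝ, (∀ t, T ≤ t → 0 < x t ∧ x t = φ (x (t + 1) + d (t + 1))) →
      ∃ p, IsBackwardOrbit φ d p ∧ ∀ t, T ≤ t → p t = x t := by
  induction T with
  | zero => exact fun x hx => ⟨x, fun t => hx t t.zero_le, fun _ _ => rfl⟩
  | succ T ih =>
    intro x hx
    have hne : ∀ t, T < t →
        Function.update x T (φ (x (T + 1) + d (T + 1))) t = x t := fun t ht =>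
      Function.update_of_ne (by omega) _ _
    obtain ⟨p, hp, hpx⟩ := ih (Function.update x T (φ (x (T + 1) + d (T + 1)))) (by
      intro t ht
      rcases ht.eq_or_lt with rfl | ht
      · rw [hne _ (Nat.lt_succ_self _), Function.update_self]
        exact ⟨hφ _ (add_pos (hx _ le_rfl).1 (hd _)), rfl⟩
      · rw [hne _ ht, hne _ (ht.trans (Nat.lt_succ_self _))]
        exact hx t ht)
    exact ⟨p, hp, fun t ht => (hpx t (by omega)).trans (hne t ht)⟩

lemma IsBackwardOrbit.eq_of_tail_eq {p p' : ℕ → ℝ} (hp : IsBackwardOrbit φ d p)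
    (hp' : IsBackwardOrbit φ d p') (T : ℕ) (h : ∀ t, T ≤ t → p t = p' t) : p = p' := by
  induction T with
  | zero => exact funext fun t => h t t.zero_le
  | succ T ih =>
    refine ih fun t ht => ?_
    rcases ht.eq_or_lt with rfl | ht
    · rw [(hp _).2, (hp' _).2, h _ le_rfl]
    · exact h t ht

/-- Compactness: if the backward recursion maps the interval of date `t + 1` into that of date `t`,
some solution stays in these intervals. -/
lemma exists_backwardOrbit_mem_Icc (hφ : ∀ s, 0 < s → 0 < φ s)
    (hφc : ContinuousOn φ (Set.Ioi 0)) (hd : ∀ t, 0 < d t) (T : ℕ) {lo hi : ℕ → ℝ}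
    (hle : ∀ t, lo t ≤ hi t)
    (hpos : ∀ t, T ≤ t → ∀ x ∈ Set.Icc (lo (t + 1)) (hi (t + 1)), 0 < x + d (t + 1))
    (hmaps : ∀ t, T ≤ t → ∀ x ∈ Set.Icc (lo (t + 1)) (hi (t + 1)),
      φ (x + d (t + 1)) ∈ Set.Icc (lo t) (hi t)) :
    ∃ p, IsBackwardOrbit φ d p ∧ ∀ t, T ≤ t → p t ∈ Set.Icc (lo t) (hi t) := by
  -- `K n` collects the sequences that solve the recursion at the dates `T, …, T + n - 1`
  let K : ℕ → Set (ℕ → ℝ) := fun n => (Set.univ.pi fun t => Set.Icc (lo t) (hi t)) ∩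
    {x | ∀ t, T ≤ t → t < T + n → x t = φ (x (t + 1) + d (t + 1))}
  have hbox : IsCompact (Set.univ.pi fun t => Set.Icc (lo t) (hi t)) :=
    isCompact_univ_pi fun t => isCompact_Icc
  have hclosed : ∀ n, IsClosed (K n) := by
    intro n
    have hKn : K n = ⋂ t, {x ∈ Set.univ.pi fun t => Set.Icc (lo t) (hi t) |
        T ≤ t → t < T + n → x t = φ (x (t + 1) + d (t + 1))} := by
      ext x
      simp only [K, Set.mem_inter_iff, Set.mem_ofPred_eq, Set.mem_iInter]
      exact ⟨fun h t => ⟨h.1, h.2 t⟩, fun h => ⟨(h 0).1, fun t => (h t).2⟩⟩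
    rw [hKn]
    refine isClosed_iInter fun t => ?_
    by_cases ht : T ≤ t ∧ t < T + n
    · have hset : {x ∈ Set.univ.pi fun t => Set.Icc (lo t) (hi t) |
          T ≤ t → t < T + n → x t = φ (x (t + 1) + d (t + 1))}
          = {x ∈ Set.univ.pi fun t => Set.Icc (lo t) (hi t) |
            x t - φ (x (t + 1) + d (t + 1)) = 0} := by
        ext x; simp [ht.1, ht.2, sub_eq_zero]
      rw [hset]
      have hcont : ContinuousOn (fun x : ℕ → ℝ => x t - φ (x (t + 1) + d (t + 1)))
          (Set.univ.pi fun t => Set.Icc (lo t) (hi t)) := by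
        refine (continuous_apply t).continuousOn.sub (hφc.comp
          ((continuous_apply (t + 1)).add continuous_const).continuousOn fun x hx => ?_)
        exact hpos t ht.1 _ (hx (t + 1) trivial)
      exact hcont.preimage_isClosed_of_isClosed hbox.isClosed isClosed_singleton
    · have hset : {x ∈ Set.univ.pi fun t => Set.Icc (lo t) (hi t) |
          T ≤ t → t < T + n → x t = φ (x (t + 1) + d (t + 1))}
          = Set.univ.pi fun t => Set.Icc (lo t) (hi t) := by
        ext x; simp only [Set.mem_ofPred_eq, and_iff_left_iff_imp]
        exact fun _ h1 h2 => absurd ⟨h1, h2⟩ ht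
      rw [hset]; exact hbox.isClosed
  have hnonempty : ∀ n T', T ≤ T' → ∃ x ∈ Set.univ.pi fun t => Set.Icc (lo t) (hi t),
      ∀ t, T' ≤ t → t < T' + n → x t = φ (x (t + 1) + d (t + 1)) := by
    intro n
    induction n with
    | zero => exact fun T' _ => ⟨lo, fun t _ => ⟨le_rfl, hle t⟩, fun t h1 h2 => by omega⟩
    | succ n ih =>
      intro T' hT'
      obtain ⟨x, hx, hrec⟩ := ih (T' + 1) (by omega)
      have hne : ∀ t, T' < t →
          Function.update x T' (φ (x (T' + 1) + d (T' + 1))) t = x t := fun t ht =>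
        Function.update_of_ne (by omega) _ _
      refine ⟨Function.update x T' (φ (x (T' + 1) + d (T' + 1))), fun t _ => ?_, fun t h1 h2 => ?_⟩
      · by_cases ht : t = T'
        · subst ht
          rw [Function.update_self]
          exact hmaps _ hT' _ (hx _ trivial)
        · rw [Function.update_of_ne ht]
          exact hx t trivial
      · rcases h1.eq_or_lt with rfl | h1
        · rw [hne _ (Nat.lt_succ_self _), Function.update_self]
        · rw [hne _ h1, hne _ (h1.trans (Nat.lt_succ_self _))]
          exact hrec t h1 (by omega)
  obtain ⟨x, hx⟩ := IsCompact.nonempty_iInter_of_sequence_nonempty_isCompact_isClosed K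
    (fun n x hx => ⟨hx.1, fun t h1 h2 => hx.2 t h1 (by omega)⟩)
    (fun n => by
      obtain ⟨x, hx, h⟩ := hnonempty n T le_rfl
      exact ⟨x, hx, h⟩)
    (hbox.of_isClosed_subset (hclosed 0) Set.inter_subset_left) hclosed
  rw [Set.mem_iInter] at hx
  have hmem : ∀ t, x t ∈ Set.Icc (lo t) (hi t) := fun t => (hx 0).1 t trivial
  have hrec : ∀ t, T ≤ t → x t = φ (x (t + 1) + d (t + 1)) := fun t ht =>
    (hx (t + 1)).2 t ht (by omega)
  obtain ⟨p, hp, hpx⟩ := exists_backwardOrbit_of_tail hφ hd T x fun t ht =>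
    ⟨by rw [hrec t ht]; exact hφ _ (hpos t ht _ (hmem _)), hrec t ht⟩
  exact ⟨p, hp, fun t ht => by rw [hpx t ht]; exact hmem t⟩

/-- Forward construction: if every value admissible at date `t ≥ T` has an admissible successor,
some solution takes a given admissible value at `T` and admissible values from then on. -/
lemma exists_backwardOrbit_forward (hφ : ∀ s, 0 < s → 0 < φ s) (hd : ∀ t, 0 < d t) (T : ℕ)
    {I : ℕ → ℝ → Prop} (hpos : ∀ t x, T ≤ t → I t x → 0 < x)
    (hstep : ∀ t x, T ≤ t → I t x → ∃ x', I (t + 1) x' ∧ x = φ (x' + d (t + 1)))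
    {x₀ : ℝ} (hx₀ : I T x₀) :
    ∃ p, IsBackwardOrbit φ d p ∧ p T = x₀ ∧ ∀ t, T ≤ t → I t (p t) := by
  choose! f hf using hstep
  let y : ℕ → ℝ := fun n => Nat.rec x₀ (fun n x => f (T + n) x) n
  have hy : ∀ n, I (T + n) (y n) := by
    intro n
    induction n with
    | zero => exact hx₀
    | succ n ih => exact (hf (T + n) (y n) (by omega) ih).1
  obtain ⟨p, hp, hpx⟩ := exists_backwardOrbit_of_tail hφ hd T (fun t => y (t - T)) (by
    intro t ht
    obtain ⟨n, rfl⟩ := Nat.exists_eq_add_of_le ht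
    rw [show T + n - T = n by omega, show T + n + 1 - T = n + 1 by omega]
    exact ⟨hpos _ _ ht (hy n), (hf (T + n) (y n) ht (hy n)).2⟩)
  refine ⟨p, hp, ?_, fun t ht => ?_⟩
  · rw [hpx T le_rfl, Nat.sub_self]
    rfl
  · obtain ⟨n, rfl⟩ := Nat.exists_eq_add_of_le ht
    rw [hpx _ ht, show T + n - T = n by omega]
    exact hy n

/-- Two distinct solutions that tend to zero separate at least at the geometric rate `l`, when `φ`
is increasing with slope at most `1 / l` near zero. -/
lemma IsBackwardOrbit.exists_separation {l r : ℝ} (hl : 0 < l) (hr : 0 < r)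
    (hmono : MonotoneOn φ (Set.Ioc 0 r))
    (hslope : ∀ s s', 0 < s → s ≤ s' → l * (φ s' - φ s) ≤ s' - s) (hd : ∀ t, 0 < d t)
    (hd0 : Tendsto d atTop (𝓝 0)) {p p' : ℕ → ℝ} (hp : IsBackwardOrbit φ d p)
    (hp' : IsBackwardOrbit φ d p') (h0 : Tendsto p atTop (𝓝 0)) (h0' : Tendsto p' atTop (𝓝 0))
    (hne : p ≠ p') : ∃ c, 0 < c ∧ ∀ᶠ t in atTop, c * l ^ t ≤ |p t - p' t| := by
  have hlt : ∀ {q : ℕ → ℝ}, Tendsto q atTop (𝓝 0) → ∀ᶠ t in atTop, q t + d t < r := fun hq =>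
    (hq.add hd0).eventually_lt_const (by simpa using hr)
  obtain ⟨T, hT⟩ := eventually_atTop.1 ((hlt h0).and (hlt h0'))
  obtain ⟨t₀, ht₀, hne₀⟩ : ∃ t, T ≤ t ∧ p t ≠ p' t := by
    by_contra! h
    exact hne (hp.eq_of_tail_eq hp' T h)
  have hkey : ∀ s s', s ∈ Set.Ioc 0 r → s' ∈ Set.Ioc 0 r → l * |φ s - φ s'| ≤ |s - s'| := by
    intro s s' hs hs'
    rcases le_total s s' with h | h
    · rw [abs_sub_comm, abs_sub_comm s, abs_of_nonneg (sub_nonneg.2 (hmono hs hs' h)),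
        abs_of_nonneg (sub_nonneg.2 h)]
      exact hslope _ _ hs.1 h
    · rw [abs_of_nonneg (sub_nonneg.2 (hmono hs' hs h)), abs_of_nonneg (sub_nonneg.2 h)]
      exact hslope _ _ hs'.1 h
  have hstep : ∀ t, T ≤ t → l * |p t - p' t| ≤ |p (t + 1) - p' (t + 1)| := by
    intro t ht
    have h1 := hT (t + 1) (by omega)
    have h2 := hkey (p (t + 1) + d (t + 1)) (p' (t + 1) + d (t + 1))
      ⟨add_pos (hp _).1 (hd _), h1.1.le⟩ ⟨add_pos (hp' _).1 (hd _), h1.2.le⟩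
    rwa [← (hp t).2, ← (hp' t).2, add_sub_add_right_eq_sub] at h2
  have hlp := pow_pos hl t₀
  refine ⟨|p t₀ - p' t₀| / l ^ t₀, div_pos (abs_pos.2 (sub_ne_zero.2 hne₀)) hlp, ?_⟩
  filter_upwards [eventually_ge_atTop t₀] with t ht
  induction t, ht using Nat.le_induction with
  | base => rw [div_mul_cancel₀ _ hlp.ne']
  | succ t ht ih =>
    refine le_trans ?_ (hstep t (ht₀.trans ht))
    rw [pow_succ, ← mul_assoc, mul_comm _ l]
    exact mul_le_mul_of_nonneg_left ih hl.le

/-- If `φ s ≥ s / θ` near zero with `θ < 1`, then every value between a solution that tends to zero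
and some bound is taken, at a common date, by a solution that tends to zero. -/
lemma IsBackwardOrbit.exists_forall_tendsto_zero (hφ : ∀ s, 0 < s → 0 < φ s)
    (hφc : ContinuousOn φ (Set.Ioi 0)) (hd : ∀ t, 0 < d t) (hd0 : Tendsto d atTop (𝓝 0))
    {θ r : ℝ} (hθ0 : 0 < θ) (hθ1 : θ < 1) (hr : 0 < r)
    (hexp : ∀ s, 0 < s → s ≤ r → s ≤ θ * φ s)
    {q : ℕ → ℝ} (hq : IsBackwardOrbit φ d q) (hq0 : Tendsto q atTop (𝓝 0)) :
    ∃ T, q T < r ∧ ∀ x ∈ Set.Icc (q T) r, ∃ p, IsBackwardOrbit φ d p ∧ p T = x ∧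
      Tendsto p atTop (𝓝 0) := by
  have hlt : ∀ᶠ t in atTop, q t + d t < r :=
    (hq0.add hd0).eventually_lt_const (by simpa using hr)
  obtain ⟨T, hT⟩ := eventually_atTop.1 hlt
  refine ⟨T, by linarith [hT T le_rfl, hd T], fun x hx => ?_⟩
  have hθT := pow_pos hθ0 T
  have hr' : 0 < r / θ ^ T := div_pos hr hθT
  have hbound : ∀ t, T ≤ t → r / θ ^ T * θ ^ t ≤ r := by
    intro t ht
    rw [div_mul_eq_mul_div, div_le_iff₀ hθT]
    exact mul_le_mul_of_nonneg_left (pow_le_pow_of_le_one hθ0.le hθ1.le ht) hr.le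
  obtain ⟨p, hp, hpT, hpI⟩ := exists_backwardOrbit_forward hφ hd T
    (I := fun t x => q t ≤ x ∧ x ≤ r / θ ^ T * θ ^ t)
    (fun t x _ h => (hq t).1.trans_le h.1) (by
      rintro t x ht ⟨h1, h2⟩
      -- the payoff is sought between the one of `q` and `θ * x`
      have hx0 := (hq t).1.trans_le h1
      have hθx := mul_pos hθ0 hx0
      have hs0 := add_pos (hq (t + 1)).1 (hd (t + 1))
      have hsr := (hT (t + 1) (by omega)).le
      have hleft : φ (q (t + 1) + d (t + 1)) ≤ x := by rw [← (hq t).2]; exact h1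
      have hright : x ≤ φ (θ * x) := by
        have h3 := hexp (θ * x) hθx (by
          have := h2.trans (hbound t ht)
          nlinarith)
        exact le_of_mul_le_mul_left h3 hθ0
      have horder : q (t + 1) + d (t + 1) ≤ θ * x :=
        (hexp _ hs0 hsr).trans (mul_le_mul_of_nonneg_left hleft hθ0.le)
      obtain ⟨s, hs, hsx⟩ := intermediate_value_Icc horder
        (hφc.mono fun s hs => hs0.trans_le hs.1) ⟨hleft, hright⟩
      refine ⟨s - d (t + 1), ⟨by linarith [hs.1], ?_⟩, by rw [sub_add_cancel, hsx]⟩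
      rw [pow_succ]
      have := mul_le_mul_of_nonneg_left h2 hθ0.le
      linarith [hs.2, hd (t + 1)])
    (x₀ := x) ⟨hx.1, by rw [div_mul_cancel₀ _ hθT.ne']; exact hx.2⟩
  refine ⟨p, hp, hpT, ?_⟩
  refine squeeze_zero' (Eventually.of_forall fun t => (hp t).1.le)
    ((eventually_ge_atTop T).mono fun t ht => (hpI t ht).2) ?_
  simpa using (tendsto_pow_atTop_nhds_zero_of_lt_one hθ0.le hθ1).const_mul (r / θ ^ T)

/-- Around a fixed point where the modulus of the derivative exceeds `K`, the image of every small
interval of radius `r` contains the interval of radius `K r`. -/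
lemma exists_preimage_near_fixedPoint {q L K : ℝ} (hK : 0 < K) (hKL : K < |L|)
    (hfix : φ q = q) (hderiv : HasDerivAt φ L q) (hφc : ContinuousOn φ (Set.Ioi 0))
    (hq : 0 < q) : ∃ ε, 0 < ε ∧ ∀ x, |x - q| ≤ ε → ∃ s, |s - q| ≤ |x - q| / K ∧ φ s = x := by
  have hev := hderiv.isLittleO.bound (sub_pos.2 hKL)
  obtain ⟨ε, hε, hball⟩ := Metric.eventually_nhds_iff.1 hev
  have hm : 0 < min ε q / 2 := by positivity
  refine ⟨K * (min ε q / 2), by positivity, fun x hx => ?_⟩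
  set r := |x - q| / K with hr
  have hr0 : 0 ≤ r := by positivity
  have hrle : r ≤ min ε q / 2 := by rw [hr, div_le_iff₀ hK, mul_comm]; exact hx
  have hrε : r < ε := by have := min_le_left ε q; linarith
  have hrq : r < q := by have := min_le_right ε q; linarith
  have hxr : |x - q| = K * r := by rw [hr]; field_simp
  have hplus := hball (y := q + r) (by simpa [Real.dist_eq, abs_of_nonneg hr0] using hrε)
  have hminus := hball (y := q - r) (by simpa [Real.dist_eq, abs_of_nonneg hr0] using hrε)
  simp only [hfix, Real.norm_eq_abs, smul_eq_mul, add_sub_cancel_left, sub_sub_cancel_left,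
    abs_of_nonneg hr0, abs_neg] at hplus hminus
  have hcont : ContinuousOn φ (Set.Icc (q - r) (q + r)) :=
    hφc.mono fun s hs => (by linarith [hs.1] : (0 : ℝ) < s)
  rw [abs_le] at hplus hminus
  have hx' := abs_le.1 hxr.le
  have hsol : ∃ s ∈ Set.Icc (q - r) (q + r), φ s = x := by
    rcases le_total 0 L with hL | hL
    · rw [abs_of_nonneg hL] at hplus hminus
      exact intermediate_value_Icc (by linarith) hcont ⟨by nlinarith, by nlinarith⟩
    · rw [abs_of_nonpos hL] at hplus hminus
      exact intermediate_value_Icc' (by linarith) hcont ⟨by nlinarith, by nlinarith⟩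
  obtain ⟨s, hs, hsx⟩ := hsol
  exact ⟨s, abs_le.2 ⟨by linarith [hs.1], by linarith [hs.2]⟩, hsx⟩

/-- A positive fixed point of `φ` is the limit of a solution, whatever the derivative of `φ` there.
If the derivative is below `1 / κ` in modulus, the geometric decay of `d` makes a tube of radius
`C κ ^ t` invariant under the backward recursion; otherwise the forward recursion contracts. -/
lemma exists_backwardOrbit_tendsto_fixedPoint (hφ : ∀ s, 0 < s → 0 < φ s)
    (hφc : ContinuousOn φ (Set.Ioi 0)) {D κ q : ℝ} (hD : 0 < D) (hκ0 : 0 < κ) (hκ1 : κ < 1)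
    (hq : 0 < q) (hfix : φ q = q) (hdiff : DifferentiableAt ℝ φ q) :
    ∃ p, IsBackwardOrbit φ (fun t => D * κ ^ t) p ∧ Tendsto p atTop (𝓝 q) := by
  set L := deriv φ q
  have hderiv : HasDerivAt φ L q := hdiff.hasDerivAt
  have hd : ∀ t : ℕ, 0 < D * κ ^ t := fun t => by positivity
  have hsmall : ∀ A η θ : ℝ, 0 < η → 0 ≤ θ → θ < 1 → ∃ T : ℕ, ∀ t, T ≤ t → A * θ ^ t < η := by
    intro A η θ hη h0 h1
    have := (tendsto_pow_atTop_nhds_zero_of_lt_one h0 h1).const_mul A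
    exact eventually_atTop.1 (this.eventually_lt_const (by simpa using hη))
  have hlim : ∀ (p : ℕ → ℝ) (A θ : ℝ) (T : ℕ), 0 ≤ θ → θ < 1 →
      (∀ t, T ≤ t → |p t - q| ≤ A * θ ^ t) → Tendsto p atTop (𝓝 q) := by
    intro p A θ T h0 h1 h
    rw [tendsto_iff_dist_tendsto_zero]
    refine squeeze_zero' (Eventually.of_forall fun t => dist_nonneg)
      ((eventually_ge_atTop T).mono h) ?_
    simpa using (tendsto_pow_atTop_nhds_zero_of_lt_one h0 h1).const_mul A
  rcases lt_or_ge (|L| * κ) 1 with hL | hL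
  · obtain ⟨K, hLK, hKκ⟩ : ∃ K, |L| < K ∧ K < 1 / κ :=
      exists_between ((lt_div_iff₀ hκ0).2 hL)
    rw [lt_div_iff₀ hκ0] at hKκ
    have hK : 0 < K := (abs_nonneg L).trans_lt hLK
    obtain ⟨ε, hε, hball⟩ := Metric.eventually_nhds_iff.1
      (hderiv.isLittleO.bound (sub_pos.2 hLK))
    have hlip : ∀ s, |s - q| < ε → |φ s - q| ≤ K * |s - q| := by
      intro s hs
      have h1 := hball (y := s) (by rwa [Real.dist_eq])
      simp only [hfix, Real.norm_eq_abs, smul_eq_mul] at h1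
      have h2 := abs_add_le (φ s - q - (s - q) * L) ((s - q) * L)
      rw [sub_add_cancel, abs_mul] at h2
      linarith
    -- the radius solves `C = K κ (C + D)`
    set C := K * κ * D / (1 - K * κ) with hC
    have h1K : 0 < 1 - K * κ := by linarith
    have hC0 : 0 < C := by positivity
    have hCeq : K * κ * (C + D) = C := by rw [hC]; field_simp; ring
    obtain ⟨T, hT⟩ := hsmall (C + D) (min ε q) κ (lt_min hε hq) hκ0.le hκ1
    have hnear : ∀ t, T ≤ t → ∀ x ∈ Set.Icc (q - C * κ ^ (t + 1)) (q + C * κ ^ (t + 1)),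
        |x + D * κ ^ (t + 1) - q| ≤ (C + D) * κ ^ (t + 1) := by
      intro t _ x hx
      have := pow_pos hκ0 (t + 1)
      rw [abs_le]
      constructor <;> nlinarith [hx.1, hx.2, mul_pos hD this, mul_pos hC0 this]
    obtain ⟨p, hp, hpI⟩ := exists_backwardOrbit_mem_Icc hφ hφc hd T
      (lo := fun t => q - C * κ ^ t) (hi := fun t => q + C * κ ^ t)
      (fun t => by
        have := mul_pos hC0 (pow_pos hκ0 t)
        linarith)
      (fun t ht x hx => by
        have h1 := hnear t ht x hx
        have h2 := hT (t + 1) (by omega)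
        have h3 := min_le_right ε q
        have h4 := (abs_le.1 h1).1
        linarith)
      (fun t ht x hx => by
        have h1 := hnear t ht x hx
        have h2 := hT (t + 1) (by omega)
        have h3 := min_le_left ε q
        have h4 := hlip _ (h1.trans_lt (by linarith))
        have h5 : K * |x + D * κ ^ (t + 1) - q| ≤ C * κ ^ t := by
          calc K * |x + D * κ ^ (t + 1) - q| ≤ K * ((C + D) * κ ^ (t + 1)) :=
                mul_le_mul_of_nonneg_left h1 hK.le
            _ = K * κ * (C + D) * κ ^ t := by ring
            _ = C * κ ^ t := by rw [hCeq]
        have h6 := abs_le.1 (h4.trans h5)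
        exact ⟨by linarith [h6.1], by linarith [h6.2]⟩)
    exact ⟨p, hp, hlim p C κ T hκ0.le hκ1 fun t ht =>
      abs_le.2 ⟨by linarith [(hpI t ht).1], by linarith [(hpI t ht).2]⟩⟩
  · have hL1 : 1 < |L| := by
      by_contra! h
      nlinarith [abs_nonneg L]
    obtain ⟨K, hK1, hKL⟩ := exists_between hL1
    have hK : 0 < K := by linarith
    obtain ⟨ε, hε, hpre⟩ := exists_preimage_near_fixedPoint hK hKL hfix hderiv hφc hq
    obtain ⟨θ, hθ, hθ1⟩ : ∃ θ, max κ (1 / K) < θ ∧ θ < 1 :=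
      exists_between (max_lt hκ1 ((div_lt_one hK).2 hK1))
    have hκθ : κ < θ := (le_max_left _ _).trans_lt hθ
    have hKθ : 1 / K < θ := (le_max_right _ _).trans_lt hθ
    have hθ0 : 0 < θ := hκ0.trans hκθ
    -- the radius solves `A / K + D κ = A θ`
    set A := D * κ / (θ - 1 / K) with hA
    have hsub : 0 < θ - 1 / K := by linarith
    have hA0 : 0 < A := by positivity
    have hAeq : A * (1 / K) + D * κ = A * θ := by
      have : A * (θ - 1 / K) = D * κ := by rw [hA]; exact div_mul_cancel₀ _ hsub.ne'
      linarith
    obtain ⟨T, hT⟩ := hsmall A (min ε q) θ (lt_min hε hq) hθ0.le hθ1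
    obtain ⟨p, hp, -, hpI⟩ := exists_backwardOrbit_forward hφ hd T
      (I := fun t x => |x - q| ≤ A * θ ^ t)
      (fun t x ht hx => by
        have h1 := hT t ht
        have h2 := min_le_right ε q
        linarith [(abs_le.1 hx).1])
      (fun t x ht hx => by
        have h1 := hT t ht
        have h2 := min_le_left ε q
        obtain ⟨s, hs, hsx⟩ := hpre x (by linarith)
        refine ⟨s - D * κ ^ (t + 1), ?_, by rw [sub_add_cancel, hsx]⟩
        have h3 : |x - q| / K ≤ A * θ ^ t * (1 / K) := by
          rw [div_eq_mul_one_div]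
          exact mul_le_mul_of_nonneg_right hx (by positivity)
        have h4 : D * κ ^ (t + 1) ≤ D * κ * θ ^ t := by
          rw [pow_succ, mul_comm (κ ^ t), ← mul_assoc]
          exact mul_le_mul_of_nonneg_left (pow_le_pow_left₀ hκ0.le hκθ.le t) (by positivity)
        have h5 : A * θ ^ t * (1 / K) + D * κ * θ ^ t = A * θ ^ (t + 1) := by
          rw [pow_succ]; linear_combination θ ^ t * hAeq
        have h6 := abs_le.1 hs
        have h7 := hd (t + 1)
        exact abs_le.2 ⟨by linarith [h6.1], by linarith [h6.2]⟩)
      (x₀ := q) (by simpa using (mul_pos hA0 (pow_pos hθ0 T)).le)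
    exact ⟨p, hp, hlim p A θ T hθ0.le hθ1 hpI⟩

end Orbits

end OLG

/-! ### Detrended price paths of the economy -/

namespace OLG

namespace IsMRS

variable {M : ℝ → ℝ} {a b G D κ : ℝ}

/-- The detrended return `s / φ s` of an asset with small payoff `s` is at most any given `θ` above
the detrended autarky return. -/
lemma exists_le_mul_backPrice_near_zero (hM : IsMRS M) (ha : 0 < a) (hb : 0 < b) (hG : 0 < G)
    {θ : ℝ} (hθ : M (G * b / a) / G < θ) :
    ∃ r, 0 < r ∧ ∀ s, 0 < s → s ≤ r → s ≤ θ * backPrice M a b G s := by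
  have h0 : 0 < G * b / a := by positivity
  rw [div_lt_iff₀ hG, mul_comm θ] at hθ
  obtain ⟨ρ, hρ, hρ'⟩ :=
    (((hM.continuousAt h0).eventually_lt_const hθ).filter_mono nhdsWithin_le_nhds
      |>.and (self_mem_nhdsWithin (s := Set.Ioi (G * b / a)))).exists
  exact ⟨ratioPayoff M a b G ρ, hM.ratioPayoff_pos ha hb.le hG hρ', fun s hs hsr =>
    hM.le_mul_backPrice ha hb.le hG hs (hM.payoffRatio_le ha hb.le hG hs hρ' hsr) hρ.le⟩

/-- When the autarky return `l` exceeds the dividend growth rate `κ`, some detrended price path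
decays exactly at the rate of dividends, with the constant `C = κ D / (l - κ)` of the stationary
price-dividend ratio. -/
lemma exists_backwardOrbit_dividend_rate (hM : IsMRS M) (ha : 0 < a) (hb : 0 < b) (hG : 0 < G)
    (hD : 0 < D) (hκ0 : 0 < κ) (hκ1 : κ < 1) (hl : κ < M (G * b / a) / G) :
    ∃ p C, 0 < C ∧ IsBackwardOrbit (backPrice M a b G) (fun t => D * κ ^ t) p ∧
      (∀ t, p t ≤ C * κ ^ t) ∧ Tendsto (fun t => p t / κ ^ t) atTop (𝓝 C) := by
  set l := M (G * b / a) / G with hl_def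
  have hl0 : 0 < l := hκ0.trans hl
  have hsub : 0 < l - κ := by linarith
  have hlow := fun s (hs : 0 < s) => hM.mul_backPrice_le ha hb hG hs
  rw [← hl_def] at hlow
  set C := κ * D / (l - κ) with hC
  have hC0 : 0 < C := by positivity
  have hCeq : κ * (C + D) = l * C := by rw [hC]; field_simp; ring
  obtain ⟨p, hp, hpI⟩ := exists_backwardOrbit_mem_Icc (φ := backPrice M a b G)
    (fun s => hM.backPrice_pos ha hb.le hG) (hM.continuousOn_backPrice ha hb.le hG)
    (d := fun t => D * κ ^ t) (fun t => by positivity) 0 (lo := fun _ => 0)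
    (hi := fun t => C * κ ^ t) (fun t => by positivity)
    (fun t _ x hx => add_pos_of_nonneg_of_pos hx.1 (by positivity))
    (fun t _ x hx => by
      have hs : 0 < x + D * κ ^ (t + 1) := add_pos_of_nonneg_of_pos hx.1 (by positivity)
      refine ⟨(hM.backPrice_pos ha hb.le hG hs).le, ?_⟩
      have h1 := hlow _ hs
      refine le_of_mul_le_mul_left (h1.trans ?_) hl0
      have h2 : C * κ ^ (t + 1) + D * κ ^ (t + 1) = l * (C * κ ^ t) := by
        rw [pow_succ]; linear_combination κ ^ t * hCeq
      linarith [hx.2])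
  have hle : ∀ t, p t ≤ C * κ ^ t := fun t => (hpI t t.zero_le).2
  refine ⟨p, C, hC0, hp, hle, ?_⟩
  rw [Metric.tendsto_atTop]
  intro ε hε
  -- a return bound `θ` slightly above `l` changes the price-dividend ratio by less than `ε`
  obtain ⟨θ, hlθ, hθε⟩ : ∃ θ, l < θ ∧ C - ε < κ * D / (θ - κ) := by
    have hcont : ContinuousAt (fun θ => κ * D / (θ - κ)) l :=
      continuousAt_const.div (continuousAt_id.sub continuousAt_const) hsub.ne'
    have h1 : ∀ᶠ θ in 𝓝[>] l, C - ε < κ * D / (θ - κ) :=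
      (hcont.eventually_const_lt (by simp only [← hC]; linarith)).filter_mono nhdsWithin_le_nhds
    obtain ⟨θ, h1, h2⟩ := (h1.and self_mem_nhdsWithin).exists
    exact ⟨θ, h2, h1⟩
  obtain ⟨r, hr, hexp⟩ := hM.exists_le_mul_backPrice_near_zero ha hb hG hlθ
  have hθ0 : 0 < θ := hl0.trans hlθ
  have hsubθ : 0 < θ - κ := by linarith
  obtain ⟨T, hT⟩ : ∃ T : ℕ, ∀ t, T ≤ t → (C + D) * κ ^ t < r := by
    have := (tendsto_pow_atTop_nhds_zero_of_lt_one hκ0.le hκ1).const_mul (C + D)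
    exact eventually_atTop.1 (this.eventually_lt_const (by simpa using hr))
  set X := κ * D / (θ - κ) with hX
  have hXeq : κ * (X + D) = θ * X := by rw [hX]; field_simp; ring
  -- iterating `p_t ≥ (p_{t+1} + d_{t+1}) / θ` gives the partial sums of a geometric series
  have hiter : ∀ n : ℕ, ∀ t, T ≤ t → X * (1 - (κ / θ) ^ n) * κ ^ t ≤ p t := by
    intro n
    induction n with
    | zero => intro t _; simpa using (hp t).1.le
    | succ n ih =>
      intro t ht
      have h1 := ih (t + 1) (by omega)
      have h2 := hexp (p (t + 1) + D * κ ^ (t + 1))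
        (add_pos (hp (t + 1)).1 (by positivity)) (by
          have := hT (t + 1) (by omega)
          have := hle (t + 1)
          linarith)
      rw [← (hp t).2] at h2
      refine le_of_mul_le_mul_left (le_trans ?_ h2) hθ0
      have h3 : θ * (X * (1 - (κ / θ) ^ (n + 1)) * κ ^ t)
          = X * (1 - (κ / θ) ^ n) * κ ^ (t + 1) + D * κ ^ (t + 1) := by
        have h4 : θ * (κ / θ) ^ (n + 1) = κ * (κ / θ) ^ n := by
          rw [pow_succ]; field_simp
        rw [pow_succ κ]
        linear_combination (-X * κ ^ t) * h4 - κ ^ t * hXeq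
      linarith
  have hlower : ∀ t, T ≤ t → X * κ ^ t ≤ p t := by
    intro t ht
    have h1 : Tendsto (fun n : ℕ => X * (1 - (κ / θ) ^ n) * κ ^ t) atTop
        (𝓝 (X * (1 - 0) * κ ^ t)) :=
      (((tendsto_pow_atTop_nhds_zero_of_lt_one (by positivity)
        ((div_lt_one hθ0).2 (by linarith))).const_sub 1).const_mul X).mul_const _
    rw [sub_zero, mul_one] at h1
    exact le_of_tendsto' h1 fun n => hiter n t ht
  refine ⟨T, fun t ht => ?_⟩
  have hκt := pow_pos hκ0 t
  have h1 : X ≤ p t / κ ^ t := (le_div_iff₀ hκt).2 (hlower t ht)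
  have h2 : p t / κ ^ t ≤ C := (div_le_iff₀ hκt).2 (hle t)
  rw [Real.dist_eq, abs_lt]
  constructor <;> linarith

/-- A detrended price path that tends to zero, and differs from one that decays at the rate of
dividends, decays at most at the rate `l > κ` of the autarky return. -/
lemma exists_ge_of_ne_dividend_rate (hM : IsMRS M) (ha : 0 < a) (hb : 0 < b) (hG : 0 < G)
    (hD : 0 < D) (hκ0 : 0 < κ) (hκ1 : κ < 1) (hl : κ < M (G * b / a) / G) {p q : ℕ → ℝ} {C : ℝ}
    (hq : IsBackwardOrbit (backPrice M a b G) (fun t => D * κ ^ t) q)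
    (hqC : ∀ t, q t ≤ C * κ ^ t)
    (hp : IsBackwardOrbit (backPrice M a b G) (fun t => D * κ ^ t) p)
    (hp0 : Tendsto p atTop (𝓝 0)) (hne : p ≠ q) :
    ∃ c, 0 < c ∧ ∀ᶠ t in atTop, c * (M (G * b / a) / G) ^ t ≤ p t := by
  set l := M (G * b / a) / G with hl_def
  have hl0 : 0 < l := hκ0.trans hl
  have hκt := tendsto_pow_atTop_nhds_zero_of_lt_one hκ0.le hκ1
  have hd0 : Tendsto (fun t : ℕ => D * κ ^ t) atTop (𝓝 0) := by simpa using hκt.const_mul D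
  have hq0 : Tendsto q atTop (𝓝 0) :=
    squeeze_zero (fun t => (hq t).1.le) hqC (by simpa using hκt.const_mul C)
  obtain ⟨r, hr, hmono⟩ := hM.exists_monotoneOn_backPrice ha hb hG
  obtain ⟨c, hc, hsep⟩ := hp.exists_separation hl0 hr hmono
    (fun s s' hs hss' => hM.mul_backPrice_sub_le ha hb hG hs hss') (fun t => by positivity)
    hd0 hq hp0 hq0 hne
  refine ⟨c / 2, by positivity, ?_⟩
  have hratio : Tendsto (fun t : ℕ => C * (κ / l) ^ t) atTop (𝓝 0) := by
    simpa using (tendsto_pow_atTop_nhds_zero_of_lt_one (by positivity)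
      ((div_lt_one hl0).2 hl)).const_mul C
  filter_upwards [hsep, hratio.eventually_lt_const (show 0 < c / 2 by positivity)] with t h1 h2
  have hlt := pow_pos hl0 t
  have h3 : C * κ ^ t ≤ c / 2 * l ^ t := by
    rw [div_pow, ← mul_div_assoc, div_lt_iff₀ hlt] at h2
    exact h2.le
  have h4 := hqC t
  have h5 := (hp t).1
  have h6 := (hq t).1
  rcases abs_cases (p t - q t) with ⟨h, -⟩ | ⟨h, -⟩
  · rw [h] at h1; linarith
  · rw [h] at h1
    have := mul_pos hc hlt
    linarith

/-- If some return above autarky is below the dividend growth rate, detrended prices are bounded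
away from zero: a small price would decay faster than dividends from then on. -/
lemma exists_pos_le_of_autarky_lt (hM : IsMRS M) (ha : 0 < a) (hb : 0 ≤ b) (hG : 0 < G)
    (hD : 0 < D) (hκ0 : 0 < κ) (hκ1 : κ < 1) {ρ₁ : ℝ} (hρ₁ : G * b / a < ρ₁)
    (hMρ₁ : M ρ₁ / G < κ) {p : ℕ → ℝ}
    (hp : IsBackwardOrbit (backPrice M a b G) (fun t => D * κ ^ t) p) :
    ∃ c, 0 < c ∧ ∀ t, c ≤ p t := by
  have hd : ∀ t : ℕ, 0 < D * κ ^ t := fun t => by positivity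
  have hs0 : ∀ t, 0 < p t + D * κ ^ t := fun t => add_pos (hp t).1 (hd t)
  have hpa : ∀ t, p t < a := fun t => by
    rw [(hp t).2]; exact hM.backPrice_lt ha hb hG (hs0 _)
  have hρ₁0 := ratio_pos ha hb hG hρ₁
  have hN : 0 < a * ρ₁ - G * b := by
    rw [div_lt_iff₀ ha] at hρ₁; linarith
  set θ := M ρ₁ / G with hθ
  have hθ0 : 0 < θ := div_pos (hM.pos _ hρ₁0) hG
  -- payoffs are below `a + D`, which bounds the consumption ratios
  have haD : 0 < a + D := by positivity
  set R := payoffRatio M a b G (a + D) with hR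
  have hR0 : 0 < R := hM.payoffRatio_pos ha hb hG haD
  have hRM := hM.pos R hR0
  have hs : ∀ t, p t + D * κ ^ t ≤ a + D := fun t => by
    have := mul_le_mul_of_nonneg_left (pow_le_one₀ (n := t) hκ0.le hκ1.le) hD.le
    linarith [hpa t]
  have hsmall : ∀ t, p t < (a * ρ₁ - G * b) / (R + M R) →
      p (t + 1) + D * κ ^ (t + 1) ≤ θ * p t := by
    intro t ht
    rw [(hp t).2]
    refine hM.le_mul_backPrice ha hb hG (hs0 _) ?_ (ρ₁ := ρ₁) (by rw [hθ]; field_simp; exact le_rfl)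
    by_contra! hlt
    have h0 := hM.payoffRatio_pos ha hb hG (hs0 (t + 1))
    have hle : payoffRatio M a b G (p (t + 1) + D * κ ^ (t + 1)) ≤ R :=
      (hM.strictMonoOn_payoffRatio ha hb hG).monotoneOn (hs0 _) haD (hs _)
    have hMle := hM.strictMonoOn.monotoneOn h0 hR0 hle
    rw [(hp t).2, backPrice, ratioPrice] at ht
    refine absurd ht (not_lt.2 (div_le_div₀ ?_ ?_ (add_pos h0 (hM.pos _ h0)) (by linarith)))
    · nlinarith
    · nlinarith
  refine ⟨_, div_pos hN (add_pos hR0 hRM), fun t => ?_⟩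
  by_contra! ht
  set c := (a * ρ₁ - G * b) / (R + M R)
  have hgeom : ∀ n : ℕ, p (t + n) ≤ θ ^ n * p t ∧ p (t + n) < c := by
    intro n
    induction n with
    | zero => simpa using ht
    | succ n ih =>
      have h1 := hsmall _ ih.2
      have h2 := hd (t + n + 1)
      have h3 := (hp (t + n)).1
      rw [← add_assoc]
      refine ⟨?_, by nlinarith [ih.2]⟩
      rw [pow_succ, mul_comm (θ ^ n), mul_assoc]
      exact (by linarith : p (t + n + 1) ≤ θ * p (t + n)).trans
        (mul_le_mul_of_nonneg_left ih.1 hθ0.le)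
  have hlim : Tendsto (fun n : ℕ => θ * p t * (θ / κ) ^ n) atTop (𝓝 0) := by
    simpa using (tendsto_pow_atTop_nhds_zero_of_lt_one (by positivity)
      ((div_lt_one hκ0).2 hMρ₁)).const_mul (θ * p t)
  obtain ⟨n, hn⟩ := (hlim.eventually_lt_const (hd (t + 1))).exists
  have h1 := hsmall _ (hgeom n).2
  have h2 := (hp (t + n + 1)).1
  have h3 := mul_le_mul_of_nonneg_left (hgeom n).1 hθ0.le
  rw [div_pow, ← mul_div_assoc, div_lt_iff₀ (pow_pos hκ0 n)] at hn
  have h4 : D * κ ^ (t + n + 1) = D * κ ^ (t + 1) * κ ^ n := by ring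
  have h5 : θ * (θ ^ n * p t) = θ * p t * θ ^ n := by ring
  linarith

end IsMRS

/-! ### Equilibria as detrended price paths -/

/-- The path of the growth economy with asset price `P_t = p_t G ^ t` and one unit of the asset held
by each generation. -/
noncomputable def detrendedPath (a b D G Gd : ℝ) (p : ℕ → ℝ) : Path where
  P := fun t => p t * G ^ t
  x := fun _ => 1
  y := fun t => a * G ^ t - p t * G ^ t
  z := fun t => b * G ^ t + (p t * G ^ t + D * Gd ^ t)

section Paths

variable {U : ℝ → ℝ → ℝ} {a b D G Gd : ℝ}

lemma detrend_pow (hG : 0 < G) (t : ℕ) : D * (Gd / G) ^ t * G ^ t = D * Gd ^ t := by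
  rw [div_pow, mul_assoc, div_mul_cancel₀ _ (pow_pos hG t).ne']

/-- The first-order condition at date `t` in levels is the one in detrended variables. -/
lemma foc_levels_iff (hM : IsMRS (mrs U 1)) (ha : 0 < a) (hb : 0 ≤ b) (hG : 0 < G) {p s : ℝ}
    (hp : 0 < p) (hpa : p < a) (hs : 0 < s) (t : ℕ) :
    p * G ^ t * mrs U 1 ((b * G ^ (t + 1) + s * G ^ (t + 1)) / (a * G ^ t - p * G ^ t))
      = s * G ^ (t + 1) ↔ p = backPrice (mrs U 1) a b G s := by
  have hGt := pow_pos hG t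
  have h1 : (b * G ^ (t + 1) + s * G ^ (t + 1)) / (a * G ^ t - p * G ^ t)
      = G * (b + s) / (a - p) := by
    rw [← sub_mul, pow_succ, show b * (G ^ t * G) + s * (G ^ t * G) = G * (b + s) * G ^ t by ring,
      mul_div_mul_right _ _ hGt.ne']
  rw [h1, ← hM.foc_iff_eq_backPrice ha hb hG hp hpa hs, pow_succ,
    show s * (G ^ t * G) = G * s * G ^ t by ring, mul_right_comm, mul_left_inj' hGt.ne']

theorem isEquilibrium_detrendedPath (hU : IsRegularUtility U) (ha : 0 < a) (hb : 0 ≤ b)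
    (hD : 0 < D) (hGd : 0 < Gd) (hG : 0 < G) {p : ℕ → ℝ}
    (hp : IsBackwardOrbit (backPrice (mrs U 1) a b G) (fun t => D * (Gd / G) ^ t) p) :
    IsEquilibrium (growthEconomy U a b D G Gd) (detrendedPath a b D G Gd p) := by
  have hM := hU.isMRS
  have hs : ∀ t, 0 < p t + D * (Gd / G) ^ t := fun t => add_pos (hp t).1 (by positivity)
  have hpa : ∀ t, p t < a := fun t => by
    rw [(hp t).2]; exact hM.backPrice_lt ha hb hG (hs _)
  have hP : ∀ t, 0 < p t * G ^ t := fun t => mul_pos (hp t).1 (pow_pos hG t)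
  have hy : ∀ t, 0 < a * G ^ t - p t * G ^ t := fun t => by
    rw [← sub_mul]; exact mul_pos (sub_pos.2 (hpa t)) (pow_pos hG t)
  have hz : ∀ t, 0 < b * G ^ t + (p t * G ^ t + D * Gd ^ t) := fun t => by
    have := hP t
    positivity
  have hpay : ∀ t, p t * G ^ t + D * Gd ^ t = (p t + D * (Gd / G) ^ t) * G ^ t := fun t => by
    rw [add_mul, detrend_pow hG]
  refine ⟨hP, hy, hz, ?_, ?_, ?_, ?_, ?_, fun _ => rfl⟩
  · simp [growthEconomy, detrendedPath]
  · intro t; simp [growthEconomy, detrendedPath]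
  · intro t; simp [growthEconomy, detrendedPath]
  · intro t h h1 h2
    refine hU.le_of_mrs (hy t) (hz (t + 1)) h1 h2 (hP t)
      (S := p (t + 1) * G ^ (t + 1) + D * Gd ^ (t + 1)) ?_ ?_
    · simp only [detrendedPath]
      rw [hpay]
      exact (foc_levels_iff hM ha hb hG (hp t).1 (hpa t) (hs _) t).2 (hp t).2
    · simp only [growthEconomy, detrendedPath]
      ring
  · intro t; simp only [growthEconomy, detrendedPath]; ring

theorem IsEquilibrium.exists_detrendedPath (hU : IsRegularUtility U) (ha : 0 < a) (hb : 0 ≤ b)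
    (hD : 0 < D) (hGd : 0 < Gd) (hG : 0 < G) {E : Path}
    (hE : IsEquilibrium (growthEconomy U a b D G Gd) E) :
    ∃ p, IsBackwardOrbit (backPrice (mrs U 1) a b G) (fun t => D * (Gd / G) ^ t) p ∧
      E = detrendedPath a b D G Gd p := by
  have hM := hU.isMRS
  have hGt : ∀ t : ℕ, 0 < G ^ t := fun t => pow_pos hG t
  have hP : ∀ t, E.P t = E.P t / G ^ t * G ^ t := fun t => (div_mul_cancel₀ _ (hGt t).ne').symm
  have hx : ∀ t, E.x t = 1 := hE.asset_clear
  have hy : ∀ t, E.y t = a * G ^ t - E.P t := fun t => by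
    have := hE.budget_young t
    rw [hx, mul_one] at this
    exact eq_sub_of_add_eq this
  have hz : ∀ t, E.z t = b * G ^ t + (E.P t + D * Gd ^ t) := by
    rintro (_ | t)
    · simpa [growthEconomy] using hE.budget_initial_old
    · have := hE.budget_old t
      rwa [hx, mul_one] at this
  refine ⟨fun t => E.P t / G ^ t, fun t => ⟨div_pos (hE.price_pos t) (hGt t), ?_⟩, ?_⟩
  · have hfoc := hU.mrs_of_optimal (h₀ := 1) (P := E.P t)
      (S := E.P (t + 1) + D * Gd ^ (t + 1)) (y₀ := a * G ^ t) (z₀ := b * G ^ (t + 1))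
      (hE.young_pos t) (hE.old_pos (t + 1)) (by rw [hy, mul_one]) (by rw [hz, mul_one])
      (hE.optimal t)
    have hp := div_pos (hE.price_pos t) (hGt t)
    have hpa : E.P t / G ^ t < a := by
      rw [div_lt_iff₀ (hGt t)]
      have := hE.young_pos t
      rw [hy] at this
      linarith
    have hs : 0 < E.P (t + 1) / G ^ (t + 1) + D * (Gd / G) ^ (t + 1) :=
      add_pos (div_pos (hE.price_pos _) (hGt _)) (by positivity)
    rw [← foc_levels_iff hM ha hb hG hp hpa hs t, add_mul, detrend_pow hG, ← hP, ← hP]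
    rwa [hy, hz] at hfoc
  · obtain ⟨P, x, y, z⟩ := E
    simp only at hP hx hy hz
    simp only [detrendedPath, Path.mk.injEq]
    refine ⟨funext hP, funext hx, funext fun t => ?_, funext fun t => ?_⟩
    · rw [← hP, hy]
    · rw [← hP, hz]

lemma growsAtRate_detrendedPath_dividend {p : ℕ → ℝ} :
    GrowsAtRate Gd (detrendedPath a b D G Gd p) ↔
      ∃ c, 0 < c ∧ Tendsto (fun t => p t / (Gd / G) ^ t) atTop (𝓝 c) := by
  have h : ∀ t, p t * G ^ t / Gd ^ t = p t / (Gd / G) ^ t := fun t => by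
    rw [div_pow, div_div_eq_mul_div]
  simp only [GrowsAtRate, detrendedPath, h]

lemma detrendedPath_price_div (hG : 0 < G) {p : ℕ → ℝ} :
    (fun t => (detrendedPath a b D G Gd p).P t / G ^ t) = p :=
  funext fun t => mul_div_cancel_right₀ _ (pow_pos hG t).ne'

lemma yield_detrendedPath (hG : 0 < G) {p : ℕ → ℝ} (t : ℕ) :
    (growthEconomy U a b D G Gd).dividend t / (detrendedPath a b D G Gd p).P t
      = D * (Gd / G) ^ t / p t := by
  simp only [growthEconomy, detrendedPath]
  rw [← detrend_pow hG, mul_div_mul_right _ _ (pow_pos hG t).ne']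

/-- Prices that decay more slowly than dividends are bubbly. -/
lemma isBubbly_detrendedPath (hD : 0 < D) (hGd : 0 < Gd) (hG : 0 < G) {p : ℕ → ℝ}
    (hp : ∀ t, 0 < p t) {c l : ℝ} (hc : 0 < c) (hl : Gd / G < l)
    (hle : ∀ᶠ t in atTop, c * l ^ t ≤ p t) :
    IsBubbly (growthEconomy U a b D G Gd) (detrendedPath a b D G Gd p) := by
  have hκ : 0 < Gd / G := by positivity
  have hl0 : 0 < l := hκ.trans hl
  refine isBubbly_of_summable_yield (fun t => mul_pos (hp t) (pow_pos hG t))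
    (fun t => by simp only [growthEconomy]; positivity) ?_
  simp_rw [yield_detrendedPath hG]
  refine Summable.of_norm_bounded_eventually_nat (g := fun t => D / c * (Gd / G / l) ^ t)
    ((summable_geometric_of_lt_one (by positivity) ((div_lt_one hl0).2 hl)).mul_left _) ?_
  filter_upwards [hle] with t ht
  have h1 := hp t
  have h2 : 0 < c * l ^ t := by positivity
  rw [Real.norm_of_nonneg (by positivity), div_pow (Gd / G), div_mul_div_comm]
  exact div_le_div_of_nonneg_left (by positivity) h2 ht

/-- Prices that decay at least as fast as dividends are fundamental. -/
lemma isFundamental_detrendedPath (hD : 0 < D) (hGd : 0 < Gd) (hG : 0 < G) {p : ℕ → ℝ}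
    (hp : ∀ t, 0 < p t) {C : ℝ} (hC : 0 < C) (hle : ∀ t, p t ≤ C * (Gd / G) ^ t) :
    IsFundamental (growthEconomy U a b D G Gd) (detrendedPath a b D G Gd p) := by
  refine isFundamental_of_yield_ge (c := D / C) (fun t => mul_pos (hp t) (pow_pos hG t))
    (fun t => by simp only [growthEconomy]; positivity) (by positivity) fun t => ?_
  simp only [growthEconomy, detrendedPath]
  rw [← detrend_pow (D := D) (Gd := Gd) hG t, ← mul_assoc]
  refine mul_le_mul_of_nonneg_right ?_ (pow_pos hG t).le
  rw [div_mul_eq_mul_div, div_le_iff₀ hC]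
  nlinarith [mul_le_mul_of_nonneg_left (hle t) hD.le]

end Paths

end OLG

/-! ### The three regimes -/

namespace OLG

section Regimes

variable {U : ℝ → ℝ → ℝ} {a b D G Gd : ℝ}

/-- Autarky return above dividend growth: one equilibrium has prices growing at the rate of
dividends, it is fundamental, and every other equilibrium with detrended prices tending to zero is
bubbly. -/
theorem exists_unique_dividend_rate (hU : IsRegularUtility U) (ha : 0 < a) (hb : 0 < b)
    (hD : 0 < D) (hGd : 0 < Gd) (hG : Gd < G) (hw : Gd < mrs U 1 (G * b / a)) :
    ∃ E₀, (IsEquilibrium (growthEconomy U a b D G Gd) E₀ ∧ GrowsAtRate Gd E₀) ∧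
      (∀ E, IsEquilibrium (growthEconomy U a b D G Gd) E → GrowsAtRate Gd E → E = E₀) ∧
      NegligibleAtRate G E₀ ∧ IsFundamental (growthEconomy U a b D G Gd) E₀ ∧
      ∀ E, IsEquilibrium (growthEconomy U a b D G Gd) E → NegligibleAtRate G E → E ≠ E₀ →
        IsBubbly (growthEconomy U a b D G Gd) E := by
  have hG0 : 0 < G := hGd.trans hG
  have hM := hU.isMRS
  have hκ0 : 0 < Gd / G := by positivity
  have hκ1 : Gd / G < 1 := (div_lt_one hG0).2 hG
  have hl : Gd / G < mrs U 1 (G * b / a) / G := div_lt_div_of_pos_right hw hG0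
  have hl0 := hκ0.trans hl
  have hκt := tendsto_pow_atTop_nhds_zero_of_lt_one hκ0.le hκ1
  obtain ⟨q, C, hC, hq, hqC, hlim⟩ :=
    hM.exists_backwardOrbit_dividend_rate ha hb hG0 hD hκ0 hκ1 hl
  refine ⟨detrendedPath a b D G Gd q,
    ⟨isEquilibrium_detrendedPath hU ha hb.le hD hGd hG0 hq,
      growsAtRate_detrendedPath_dividend.2 ⟨C, hC, hlim⟩⟩, ?_, ?_,
    isFundamental_detrendedPath hD hGd hG0 (fun t => (hq t).1) hC hqC, ?_⟩
  · intro E hE hgrow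
    obtain ⟨p, hp, rfl⟩ := hE.exists_detrendedPath hU ha hb.le hD hGd hG0
    obtain ⟨e, -, he⟩ := growsAtRate_detrendedPath_dividend.1 hgrow
    have hp0 : Tendsto p atTop (𝓝 0) := by
      have := he.mul hκt
      rw [mul_zero] at this
      exact this.congr fun t => div_mul_cancel₀ _ (pow_pos hκ0 t).ne'
    by_contra hne
    have hne : p ≠ q := fun h => hne (by rw [h])
    obtain ⟨c, hc, hle⟩ :=
      hM.exists_ge_of_ne_dividend_rate ha hb hG0 hD hκ0 hκ1 hl hq hqC hp hp0 hne
    have h1 : Tendsto (fun t => p t / (Gd / G) ^ t *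
        (Gd / G / (mrs U 1 (G * b / a) / G)) ^ t) atTop (𝓝 (e * 0)) :=
      he.mul (tendsto_pow_atTop_nhds_zero_of_lt_one (div_pos hκ0 hl0).le
        ((div_lt_one hl0).2 hl))
    rw [mul_zero] at h1
    obtain ⟨t, h2, h3⟩ := ((h1.eventually_lt_const hc).and hle).exists
    rw [div_pow (Gd / G), div_mul_div_cancel₀ (pow_pos hκ0 t).ne', div_lt_iff₀ (pow_pos hl0 t)]
      at h2
    exact absurd h3 (not_le.2 h2)
  · rw [NegligibleAtRate, detrendedPath_price_div hG0]
    exact squeeze_zero (fun t => (hq t).1.le) hqC (by simpa using hκt.const_mul C)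
  · intro E hE hneg hne
    obtain ⟨p, hp, rfl⟩ := hE.exists_detrendedPath hU ha hb.le hD hGd hG0
    rw [NegligibleAtRate, detrendedPath_price_div hG0] at hneg
    obtain ⟨c, hc, hle⟩ := hM.exists_ge_of_ne_dividend_rate ha hb hG0 hD hκ0 hκ1 hl hq hqC hp hneg
      (fun h => hne (by rw [h]))
    exact isBubbly_detrendedPath hD hGd hG0 (fun t => (hp t).1) hc hl hle

/-- Autarky return below economic growth: some bubbly equilibrium has prices growing with the
economy. -/
theorem exists_bubbly_growth_rate (hU : IsRegularUtility U) (ha : 0 < a) (hb : 0 ≤ b)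
    (hD : 0 < D) (hGd : 0 < Gd) (hG : Gd < G) {ρ : ℝ} (hρ : G * b / a < ρ)
    (hMρ : mrs U 1 ρ = G) :
    ∃ E, IsEquilibrium (growthEconomy U a b D G Gd) E ∧ GrowsAtRate G E ∧
      IsBubbly (growthEconomy U a b D G Gd) E := by
  have hG0 : 0 < G := hGd.trans hG
  have hM := hU.isMRS
  have hκ1 : Gd / G < 1 := (div_lt_one hG0).2 hG
  have hq := hM.ratioPrice_pos ha hb hG0 hρ
  obtain ⟨p, hp, hlim⟩ := exists_backwardOrbit_tendsto_fixedPoint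
    (fun s => hM.backPrice_pos ha hb hG0) (hM.continuousOn_backPrice ha hb hG0) hD
    (div_pos hGd hG0) hκ1 hq (hM.backPrice_ratioPrice ha hb hG0 hρ hMρ)
    (hM.differentiableAt_backPrice ha hb hG0 hq)
  refine ⟨detrendedPath a b D G Gd p, isEquilibrium_detrendedPath hU ha hb hD hGd hG0 hp,
    ⟨_, hq, by rwa [detrendedPath_price_div hG0]⟩,
    isBubbly_detrendedPath hD hGd hG0 (fun t => (hp t).1) (half_pos hq) hκ1 ?_⟩
  filter_upwards [hlim.eventually_const_lt (half_lt_self hq)] with t ht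
  rw [one_pow, mul_one]
  exact ht.le

/-- Autarky return below dividend growth: every equilibrium is bubbly. -/
theorem isBubbly_of_autarky_lt (hU : IsRegularUtility U) (ha : 0 < a) (hb : 0 ≤ b)
    (hD : 0 < D) (hGd : 0 < Gd) (hG : Gd < G) {ρ : ℝ} (hρ : G * b / a < ρ)
    (hMρ : mrs U 1 ρ = Gd) {E : Path} (hE : IsEquilibrium (growthEconomy U a b D G Gd) E) :
    IsBubbly (growthEconomy U a b D G Gd) E := by
  have hG0 : 0 < G := hGd.trans hG
  have hM := hU.isMRS
  have hκ1 : Gd / G < 1 := (div_lt_one hG0).2 hG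
  obtain ⟨p, hp, rfl⟩ := hE.exists_detrendedPath hU ha hb hD hGd hG0
  obtain ⟨ρ₁, hρ₁, hρ₁ρ⟩ := exists_between hρ
  have hlt : mrs U 1 ρ₁ / G < Gd / G := by
    refine div_lt_div_of_pos_right ?_ hG0
    rw [← hMρ]
    exact hM.strictMonoOn (IsMRS.ratio_pos ha hb hG0 hρ₁) (IsMRS.ratio_pos ha hb hG0 hρ) hρ₁ρ
  obtain ⟨c, hc, hle⟩ := hM.exists_pos_le_of_autarky_lt ha hb hG0 hD (div_pos hGd hG0) hκ1 hρ₁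
    hlt hp
  exact isBubbly_detrendedPath hD hGd hG0 (fun t => (hp t).1) hc hκ1
    (Eventually.of_forall fun t => by simpa using hle t)

/-- Autarky return between dividend growth and economic growth: the equilibria with detrended prices
tending to zero are as numerous as their prices at a late date, which fill an interval. -/
theorem mk_negligible_equilibria (hU : IsRegularUtility U) (ha : 0 < a) (hb : 0 < b)
    (hD : 0 < D) (hGd : 0 < Gd) (hG : Gd < G) (hw : mrs U 1 (G * b / a) < G) {E₀ : Path}
    (hE₀ : IsEquilibrium (growthEconomy U a b D G Gd) E₀) (hneg : NegligibleAtRate G E₀) :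
    Cardinal.mk {E : Path // IsEquilibrium (growthEconomy U a b D G Gd) E ∧
      NegligibleAtRate G E} = Cardinal.continuum := by
  have hG0 : 0 < G := hGd.trans hG
  have hM := hU.isMRS
  have hκ0 : 0 < Gd / G := by positivity
  have hκ1 : Gd / G < 1 := (div_lt_one hG0).2 hG
  refine le_antisymm ?_ ?_
  · have hsub : {E : Path | IsEquilibrium (growthEconomy U a b D G Gd) E ∧ NegligibleAtRate G E}
        ⊆ Set.range (detrendedPath a b D G Gd) := by
      rintro E ⟨hE, -⟩
      obtain ⟨p, -, rfl⟩ := hE.exists_detrendedPath hU ha hb.le hD hGd hG0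
      exact ⟨p, rfl⟩
    refine (Cardinal.mk_le_mk_of_subset hsub).trans (Cardinal.mk_range_le.trans ?_)
    simp [Cardinal.mk_real]
  · obtain ⟨q, hq, rfl⟩ := hE₀.exists_detrendedPath hU ha hb.le hD hGd hG0
    rw [NegligibleAtRate, detrendedPath_price_div hG0] at hneg
    have hl0 : 0 < mrs U 1 (G * b / a) / G := div_pos (hM.pos _ (by positivity)) hG0
    obtain ⟨θ, hθ, hθ1⟩ := exists_between ((div_lt_one hG0).2 hw)
    obtain ⟨r, hr, hexp⟩ := hM.exists_le_mul_backPrice_near_zero ha hb hG0 hθ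
    have hd0 : Tendsto (fun t : ℕ => D * (Gd / G) ^ t) atTop (𝓝 0) := by
      simpa using (tendsto_pow_atTop_nhds_zero_of_lt_one hκ0.le hκ1).const_mul D
    obtain ⟨T, hT, hex⟩ := hq.exists_forall_tendsto_zero (fun s => hM.backPrice_pos ha hb.le hG0)
      (hM.continuousOn_backPrice ha hb.le hG0) (fun t => by positivity) hd0 (hl0.trans hθ) hθ1 hr
      hexp hneg
    choose! p hp hpT hp0 using hex
    rw [← Cardinal.mk_Icc_real hT]
    refine Cardinal.mk_le_of_injective (f := fun x : Set.Icc (q T) r =>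
      ⟨detrendedPath a b D G Gd (p x),
        isEquilibrium_detrendedPath hU ha hb.le hD hGd hG0 (hp x x.2), ?_⟩) ?_
    · rw [NegligibleAtRate, detrendedPath_price_div hG0]
      exact hp0 x x.2
    · intro x x' h
      have h1 : (detrendedPath a b D G Gd (p x)).P T = (detrendedPath a b D G Gd (p x')).P T :=
        congrArg (fun E => E.P T) (congrArg Subtype.val h)
      simp only [detrendedPath, hpT x x.2, hpT x' x'.2] at h1
      exact Subtype.ext (mul_right_cancel₀ (pow_pos hG0 T).ne' h1)

end Regimes

end OLG

theorem mainTheorem1 (U : ℝ → ℝ → ℝ) (hU : OLG.IsRegularUtility U)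
    (a b D G Gd : ℝ) (ha : 0 < a) (hb : 0 ≤ b) (hD : 0 < D) (hGd : 0 < Gd) (hG : Gd < G) :
    ∃ wf wb : ℝ, 0 < wf ∧ wf < wb ∧
      -- `wf` and `wb` are the unique positive solutions of their defining equations
      (∀ w : ℝ, 0 < w → (OLG.mrs U 1 (G * w) = Gd ↔ w = wf)) ∧
      (∀ w : ℝ, 0 < w → (OLG.mrs U 1 (G * w) = G ↔ w = wb)) ∧
      -- (i)
      (wf < b / a →
        ∃ E : OLG.Path,
          (OLG.IsEquilibrium (OLG.growthEconomy U a b D G Gd) E ∧ OLG.GrowsAtRate Gd E) ∧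
          (∀ E' : OLG.Path, OLG.IsEquilibrium (OLG.growthEconomy U a b D G Gd) E' →
            OLG.GrowsAtRate Gd E' → E' = E) ∧
          OLG.IsFundamental (OLG.growthEconomy U a b D G Gd) E) ∧
      -- (ii)
      (b / a < wb →
        (∃ E : OLG.Path, OLG.IsEquilibrium (OLG.growthEconomy U a b D G Gd) E ∧
          OLG.GrowsAtRate G E ∧ OLG.IsBubbly (OLG.growthEconomy U a b D G Gd) E) ∧
        (b / a < wf → ¬ ∃ E : OLG.Path,
          OLG.IsEquilibrium (OLG.growthEconomy U a b D G Gd) E ∧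
          OLG.IsFundamental (OLG.growthEconomy U a b D G Gd) E)) ∧
      -- (iii)
      (wf < b / a → b / a < wb →
        Cardinal.mk {E : OLG.Path // OLG.IsEquilibrium (OLG.growthEconomy U a b D G Gd) E ∧
          OLG.NegligibleAtRate G E} = Cardinal.continuum ∧
        ∃ E₀ : OLG.Path,
          (OLG.IsEquilibrium (OLG.growthEconomy U a b D G Gd) E₀ ∧ OLG.GrowsAtRate Gd E₀) ∧
          OLG.NegligibleAtRate G E₀ ∧
          OLG.IsFundamental (OLG.growthEconomy U a b D G Gd) E₀ ∧
          ∀ E : OLG.Path, OLG.IsEquilibrium (OLG.growthEconomy U a b D G Gd) E →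
            OLG.NegligibleAtRate G E → E ≠ E₀ →
            OLG.IsBubbly (OLG.growthEconomy U a b D G Gd) E) := by
  have hG0 : 0 < G := hGd.trans hG
  have hM := hU.isMRS
  obtain ⟨ρf, hρf, hMf⟩ := hM.surj Gd hGd
  obtain ⟨ρb, hρb, hMb⟩ := hM.surj G hG0
  have hfb : ρf < ρb := by
    rw [← hM.strictMonoOn.lt_iff_lt hρf hρb, hMf, hMb]
    exact hG
  have huniq : ∀ {ρ g : ℝ}, 0 < ρ → OLG.mrs U 1 ρ = g →
      ∀ w : ℝ, 0 < w → (OLG.mrs U 1 (G * w) = g ↔ w = ρ / G) := by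
    intro ρ g hρ hg w hw
    rw [← hg, hM.strictMonoOn.injOn.eq_iff (mul_pos hG0 hw) hρ, eq_div_iff hG0.ne', mul_comm]
  -- comparing `w = b / a` with a threshold is comparing the autarky ratio `G b / a` with `ρ`
  have hlt : ∀ {ρ : ℝ}, b / a < ρ / G ↔ G * b / a < ρ := fun {ρ} => by
    rw [lt_div_iff₀ hG0, mul_comm, mul_div_assoc]
  have hgt : ∀ {ρ : ℝ}, ρ / G < b / a ↔ ρ < G * b / a := fun {ρ} => by
    rw [div_lt_iff₀ hG0, mul_comm, mul_div_assoc]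
  have hhigh : ρf / G < b / a → 0 < b ∧ Gd < OLG.mrs U 1 (G * b / a) := by
    intro h
    have hb0 : 0 < b := by
      have := (div_pos hρf hG0).trans h
      rcases hb.eq_or_lt with rfl | hb0
      · simp at this
      · exact hb0
    refine ⟨hb0, ?_⟩
    have h1 := hgt.1 h
    rw [← hMf]
    exact hM.strictMonoOn hρf (hρf.trans h1) h1
  refine ⟨ρf / G, ρb / G, div_pos hρf hG0, div_lt_div_of_pos_right hfb hG0, huniq hρf hMf,
    huniq hρb hMb, ?_, ?_, ?_⟩
  · intro h
    obtain ⟨hb0, hw⟩ := hhigh h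
    obtain ⟨E, hE, hunique, -, hfund, -⟩ :=
      OLG.exists_unique_dividend_rate hU ha hb0 hD hGd hG hw
    exact ⟨E, hE, hunique, hfund⟩
  · intro h
    refine ⟨OLG.exists_bubbly_growth_rate hU ha hb hD hGd hG (hlt.1 h) hMb, ?_⟩
    rintro hf ⟨E, hE, hfund⟩
    have hbub := OLG.isBubbly_of_autarky_lt hU ha hb hD hGd hG (hlt.1 hf) hMf hE 0
    exact hbub.ne' (hfund 0)
  · intro hf hb'
    obtain ⟨hb0, hw⟩ := hhigh hf
    obtain ⟨E, hE, -, hneg, hfund, hbub⟩ :=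
      OLG.exists_unique_dividend_rate hU ha hb0 hD hGd hG hw
    have h1 := hlt.1 hb'
    have hw' : OLG.mrs U 1 (G * b / a) < G := by
      have h2 := hM.strictMonoOn (Set.mem_Ioi.2 (by positivity)) hρb h1
      rwa [hMb] at h2
    exact ⟨OLG.mk_negligible_equilibria hU ha hb0 hD hGd hG hw' hE.1 hneg, E, hE, hneg, hfund,
      hbub⟩
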